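/- Let $A$ be a countably infinite set of atoms and let $M=V(A)$ be the universe of all sets over $A$ (a model of $\mathsf{ZFA}+\mathsf{AC}$, where $\mathsf{ZFA}$ is Zermelo–Fraenkel set theory with extensionality weakened to allow the set $A$ of atoms). Let $\mathcal G$ be the group of all permutations of $A$ that move only finitely many atoms; it acts on $M$ by $\pi(x)=\{\pi(y):y\in x\}$ for sets $x$. For a finite partition $P$ of $A$ put $\mathrm{fix}_{\mathcal G}(P)=\{\pi\in\mathcal G:\pi[p]=p\text{ for every block }p\in P\}$, and let $\mathcal F$ be the filter of all subgroups $H$ of $\mathcal G$ with $H\supseteq\mathrm{fix}_{\mathcal G}(P)$ for some finite partition $P$ of $A$. The finite partition model is $$\mathcal V_{fp}=\{x\in M:\ \{\pi\in\mathcal G:\pi(t)=t\}\in\mathcal F\ \text{ for every } t\in \mathrm{TC}(\{x\})\},$$ where $\mathrm{TC}$ denotes the transitive closure. For a set $X$ let $[X]^m$ be the set of its $m$-element subsets. A set $X$ is *finite* if it is in bijection with an element of $\omega$, *countable* if $|X|\le\aleph_0$, and *uncountable* otherwise. Given a coloring $\chi:[X]^m\to C$, a set $Y\subseteq X$ is *monochromatic*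 if all elements of $[Y]^m$ receive the same color (*monochromatic in color $c$* if they all receive the color $c$), and *polychromatic* if different elements of $[Y]^m$ receive different colors; $\chi$ is *$n$-bounded* if $|\chi^{-1}[\{c\}]|\le n$ for all $c\in C$. Consider the following statements, for $m,n\in\omega\setminus\{0,1\}$. * $\mathsf{CS}$: every partially ordered set without a maximal element has two disjoint cofinal subsets. * Antichain Principle $\mathsf A$: every partially ordered set has an antichain that is maximal with respect to inclusion (an antichain is a subset no two distinct elements of which are comparable). * $\mathsf{RRT}^m_n$: if $X$ and $C$ are infinite sets and $\chi:[X]^m\to C$ is $n$-bounded, then there is an infinite $Y\subseteq X$ that is polychromatic for $\chi$. * $\mathsf{RT}^m_n$: if $X$ is infinite and $\chi:[X]^m\to\{0,\dots,n-1\}$, then there is an infinite $Y\subseteq X$ that is monochromatic for $\chi$. * $\mathsf{EDM}$: if $G=(V_G,E_G)$ is a graph with $V_G$ uncountable, then for every coloring $f:[V_G]^2\to\{0,1\}$ there is an uncountable set monochromatic in color $0$ or an infinite set monochromatic in color $1$. (Equivalently: if all sets monochromatic in color $0$ are countable and all sets monochromatic in color $1$ are finite, then $V_G$ is countable.) * There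 are no amorphous sets: every infinite set is a disjoint union of two infinite subsets. **Theorem.** $\mathcal V_{fp}$ is a model of $\mathsf{ZFA}$, and in $\mathcal V_{fp}$ the following hold: 1. $\mathsf{CS}$ and $\mathsf A$; 2. $\mathsf{RRT}^m_n$ and $\mathsf{RT}^m_n$ for all $m,n\in\omega\setminus\{0,1\}$; 3. there are no amorphous sets; 4. $\mathsf{EDM}$. Consequently the theory $\mathsf{ZFA}+\mathsf{EDM}+\mathsf{CS}+{}$"there are no amorphous sets"${}+{}$"$\mathsf{RRT}^m_n$ for all $m,n\in\omega\setminus\{0,1\}$" has a model. -/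

import Mathlib

universe u v

namespace PermModel

/-! ### Structures for the language of set theory with atoms

Everything in this section speaks about an arbitrary structure `U` with a membership relation and a
predicate singling out the atoms. All quantifiers range over the elements of `U`, so that a property
such as `CS U` says that the corresponding sentence is true *in* `U`. -/

/-- A structure for the language of set theory with atoms: a membership relation (`x ∈ y`) and a
predicate for being an atom. -/
class SetStructure (U : Type v) extends Membership U U where
  IsAtom : U → Prop

section Internal

variable {U : Type v} [SetStructure U]

/-- `x` is a set, that is, not an atom. -/
def IsSet (x : U) : Prop := ¬ SetStructure.IsAtom x

/-- `x` is a subset of `y`. -/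
def IsSubset (x y : U) : Prop := IsSet x ∧ ∀ z, z ∈ x → z ∈ y

/-- `x = ∅`. -/
def IsEmptySet (x : U) : Prop := IsSet x ∧ ∀ z, z ∉ x

/-- `p = {a, b}`. -/
def IsPair (p a b : U) : Prop := IsSet p ∧ ∀ z, z ∈ p ↔ z = a ∨ z = b

/-- `p = (a, b)`, the Kuratowski pair `{{a}, {a, b}}`. -/
def IsOrderedPair (p a b : U) : Prop :=
  ∃ s t : U, IsPair s a a ∧ IsPair t a b ∧ IsPair p s t

/-- `y = x ∪ {x}`. -/
def IsSucc (y x : U) : Prop := IsSet y ∧ ∀ z, z ∈ y ↔ z ∈ x ∨ z = x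

/-- `w` contains `∅` and is closed under `x ↦ x ∪ {x}`. -/
def IsInductiveSet (w : U) : Prop :=
  IsSet w ∧ (∃ e, IsEmptySet e ∧ e ∈ w) ∧ ∀ x, x ∈ w → ∃ y, IsSucc y x ∧ y ∈ w

/-- `w = ω`, the least inductive set. -/
def IsOmega (w : U) : Prop :=
  IsInductiveSet w ∧ ∀ v : U, IsInductiveSet v → ∀ z, z ∈ w → z ∈ v

/-- `x` is the von Neumann numeral `{0, …, n - 1}`. -/
def IsNumeral : ℕ → U → Prop
  | 0, x => IsEmptySet x
  | n + 1, x => ∃ y, IsNumeral n y ∧ IsSucc x y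

/-- The ordered pair `(x, y)` belongs to `f`. -/
def Related (f x y : U) : Prop := ∃ p, IsOrderedPair p x y ∧ p ∈ f

/-- `r ⊆ X × Y`. -/
def IsRelation (r X Y : U) : Prop :=
  IsSet r ∧ ∀ p, p ∈ r → ∃ x y, x ∈ X ∧ y ∈ Y ∧ IsOrderedPair p x y

/-- `f` is a function from `X` to `Y`. -/
def IsFunction (f X Y : U) : Prop :=
  IsRelation f X Y ∧ ∀ x, x ∈ X → ∃! y, Related f x y

/-- `f` is a one-to-one function from `X` to `Y`. -/
def IsInjection (f X Y : U) : Prop :=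
  IsFunction f X Y ∧ ∀ x x' y, Related f x y → Related f x' y → x = x'

/-- `f` is a bijection from `X` onto `Y`. -/
def IsBijection (f X Y : U) : Prop :=
  IsInjection f X Y ∧ ∀ y, y ∈ Y → ∃ x, Related f x y

/-- `X` is a finite set: it is in bijection with an element of `ω`. -/
def IsFinite (X : U) : Prop :=
  IsSet X ∧ ∃ w n f : U, IsOmega w ∧ n ∈ w ∧ IsBijection f X n

/-- `X` is an infinite set. -/
def IsInfinite (X : U) : Prop := IsSet X ∧ ¬ IsFinite X

/-- `X` is a countable set: `|X| ≤ ℵ₀`. -/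
def IsCountable (X : U) : Prop :=
  IsSet X ∧ ∃ w f : U, IsOmega w ∧ IsInjection f X w

/-- `X` is an uncountable set. -/
def IsUncountable (X : U) : Prop := IsSet X ∧ ¬ IsCountable X

/-- `s ∈ [X]^m`: `s` is a subset of `X` with exactly `m` elements. -/
def IsSubsetOfSize (m : ℕ) (X s : U) : Prop :=
  IsSubset s X ∧ {z : U | z ∈ s}.encard = m

/-- `D = [X]^m`. -/
def IsSetOfSubsetsOfSize (m : ℕ) (X D : U) : Prop :=
  IsSet D ∧ ∀ s, s ∈ D ↔ IsSubsetOfSize m X s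

/-- `χ` is a coloring `[X]^m → C`. -/
def IsColoring (m : ℕ) (X C χ : U) : Prop :=
  IsSet X ∧ IsSet C ∧ ∃ D, IsSetOfSubsetsOfSize m X D ∧ IsFunction χ D C

/-- The coloring `χ` with colors in `C` is `n`-bounded: each color is used at most `n` times. -/
def IsBoundedColoring (n : ℕ) (C χ : U) : Prop :=
  ∀ c, c ∈ C → {s : U | Related χ s c}.encard ≤ n

/-- All elements of `[Y]^m` receive the same color. -/
def IsMonochromatic (m : ℕ) (χ Y : U) : Prop :=
  ∀ s t c d, IsSubsetOfSize m Y s → IsSubsetOfSize m Y t →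
    Related χ s c → Related χ t d → c = d

/-- All elements of `[Y]^m` receive the color `c`. -/
def IsMonochromaticIn (m : ℕ) (χ Y c : U) : Prop :=
  ∀ s, IsSubsetOfSize m Y s → Related χ s c

/-- Different elements of `[Y]^m` receive different colors. -/
def IsPolychromatic (m : ℕ) (χ Y : U) : Prop :=
  ∀ s t c d, IsSubsetOfSize m Y s → IsSubsetOfSize m Y t → s ≠ t →
    Related χ s c → Related χ t d → c ≠ d

/-- `R` is a partial order (reflexive, `Related R x y` meaning `x ≤ y`) on the set `P`. -/
def IsPoset (P R : U) : Prop :=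
  IsSet P ∧ IsRelation R P P ∧
    (∀ x, x ∈ P → Related R x x) ∧
    (∀ x y, Related R x y → Related R y x → x = y) ∧
    (∀ x y z, Related R x y → Related R y z → Related R x z)

/-- `x` is a maximal element of the poset `(P, R)`. -/
def IsMaximalElement (P R x : U) : Prop :=
  x ∈ P ∧ ∀ y, Related R x y → y = x

/-- `C` is a cofinal subset of the poset `(P, R)`. -/
def IsCofinal (P R C : U) : Prop :=
  IsSubset C P ∧ ∀ x, x ∈ P → ∃ c, c ∈ C ∧ Related R x c

/-- `C` is an antichain of the poset `(P, R)`. -/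
def IsAntichainIn (P R C : U) : Prop :=
  IsSubset C P ∧ ∀ x y, x ∈ C → y ∈ C → x ≠ y → ¬ Related R x y

/-- `C` is a maximal antichain of the poset `(P, R)`. -/
def IsMaximalAntichain (P R C : U) : Prop :=
  IsAntichainIn P R C ∧ ∀ D, IsAntichainIn P R D → IsSubset C D → D = C

/-- `S` is amorphous: infinite, and not a disjoint union of two infinite subsets. -/
def IsAmorphous (S : U) : Prop :=
  IsInfinite S ∧ ¬ ∃ X Y : U, IsSubset X S ∧ IsSubset Y S ∧ IsInfinite X ∧ IsInfinite Y ∧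
    (∀ z, z ∈ X → z ∉ Y) ∧ (∀ z, z ∈ S → z ∈ X ∨ z ∈ Y)

end Internal

section Principles

variable (U : Type v) [SetStructure U]

/-- Every poset without a maximal element has two disjoint cofinal subsets. -/
def CS : Prop :=
  ∀ P R : U, IsPoset P R → (∀ x, ¬ IsMaximalElement P R x) →
    ∃ C D : U, IsCofinal P R C ∧ IsCofinal P R D ∧ ∀ z, z ∈ C → z ∉ D

/-- The Antichain Principle: every poset has a maximal antichain. -/
def AntichainPrinciple : Prop :=
  ∀ P R : U, IsPoset P R → ∃ C : U, IsMaximalAntichain P R C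

/-- The rainbow Ramsey theorem: for every infinite `X`, every `n`-bounded coloring of `[X]^m` with
colors in an infinite set has an infinite polychromatic set. -/
def RRT (m n : ℕ) : Prop :=
  ∀ X C χ : U, IsInfinite X → IsInfinite C → IsColoring m X C χ → IsBoundedColoring n C χ →
    ∃ Y : U, IsSubset Y X ∧ IsInfinite Y ∧ IsPolychromatic m χ Y

/-- Ramsey's theorem: for every infinite `X`, every coloring `[X]^m → n` has an infinite
monochromatic set. -/
def RT (m n : ℕ) : Prop :=
  ∀ X N χ : U, IsInfinite X → IsNumeral n N → IsColoring m X N χ →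
    ∃ Y : U, IsSubset Y X ∧ IsInfinite Y ∧ IsMonochromatic m χ Y

/-- There are no amorphous sets. -/
def NoAmorphousSets : Prop := ∀ S : U, ¬ IsAmorphous S

/-- The Erdős–Dushnik–Miller theorem for uncountable sets: if the vertex set `V` of the graph
`(V, E)` is uncountable, then for every coloring `[V]^2 → {0, 1}` there is an uncountable set
monochromatic in color `0` or an infinite set monochromatic in color `1`. -/
def EDM : Prop :=
  ∀ V E T zero one f : U, IsUncountable V → IsSet E → (∀ e, e ∈ E → IsSubsetOfSize 2 V e) →
    IsNumeral 0 zero → IsNumeral 1 one → IsNumeral 2 T → IsColoring 2 V T f →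
    (∃ Y : U, IsSubset Y V ∧ IsUncountable Y ∧ IsMonochromaticIn 2 f Y zero) ∨
    (∃ Y : U, IsSubset Y V ∧ IsInfinite Y ∧ IsMonochromaticIn 2 f Y one)

end Principles

/-! ### The axioms of `ZFA` -/

/-- The relation symbols of the first-order language of set theory with atoms. -/
inductive SetRel : ℕ → Type
  | mem : SetRel 2
  | atom : SetRel 1

/-- The first-order language of set theory with atoms. -/
def setLanguage : FirstOrder.Language := ⟨fun _ => Empty, SetRel⟩

instance (U : Type v) [SetStructure U] : setLanguage.Structure U where
  funMap := fun f _ => nomatch f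
  RelMap := fun r x =>
    match r, x with
    | SetRel.mem, x => x 0 ∈ x 1
    | SetRel.atom, x => SetStructure.IsAtom (x 0)

/-- `U` is a model of `ZFA`. In the two schemes, `φ` is an arbitrary first-order formula and `q`
lists its parameters. -/
structure IsModelOfZFA (U : Type v) [SetStructure U] : Prop where
  atom_empty : ∀ a x : U, SetStructure.IsAtom a → x ∉ a
  set_of_atoms : ∃ a : U, IsSet a ∧ ∀ x, x ∈ a ↔ SetStructure.IsAtom x
  extensionality : ∀ x y : U, IsSet x → IsSet y → (∀ z, z ∈ x ↔ z ∈ y) → x = y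
  empty_set : ∃ x : U, IsEmptySet x
  pairing : ∀ x y : U, ∃ p : U, IsPair p x y
  union : ∀ x : U, ∃ s : U, IsSet s ∧ ∀ z, z ∈ s ↔ ∃ y, y ∈ x ∧ z ∈ y
  power_set : ∀ x : U, ∃ p : U, IsSet p ∧ ∀ z, z ∈ p ↔ IsSubset z x
  infinity : ∃ w : U, IsInductiveSet w
  foundation : ∀ x y : U, y ∈ x → ∃ z : U, z ∈ x ∧ ∀ t, t ∈ z → t ∉ x
  separation : ∀ (φ : setLanguage.Formula (Fin 1 ⊕ ℕ)) (q : ℕ → U) (x : U),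
    ∃ s : U, IsSet s ∧ ∀ z, z ∈ s ↔ z ∈ x ∧ φ.Realize (Sum.elim ![z] q)
  replacement : ∀ (φ : setLanguage.Formula (Fin 2 ⊕ ℕ)) (q : ℕ → U) (x : U),
    (∀ z y y' : U, z ∈ x → φ.Realize (Sum.elim ![z, y] q) → φ.Realize (Sum.elim ![z, y'] q) → y = y') →
    ∃ s : U, IsSet s ∧ ∀ y, y ∈ s ↔ ∃ z, z ∈ x ∧ φ.Realize (Sum.elim ![z, y] q)

/-! ### The universe of sets over a set `A` of atoms -/

/-- Codes for the elements of the cumulative hierarchy over a set `A` of atoms. -/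
inductive PreUniverse (A : Type u) : Type (u + 1)
  | atom : A → PreUniverse A
  | set (ι : Type u) (f : ι → PreUniverse A) : PreUniverse A

namespace PreUniverse

variable {A : Type u}

/-- Equality of the coded objects: sets with the same elements are equal. -/
def Equiv : PreUniverse A → PreUniverse A → Prop
  | atom a, atom b => a = b
  | atom _, set _ _ => False
  | set _ _, atom _ => False
  | set _ f, set _ g =>
      (∀ i, ∃ j, Equiv (f i) (g j)) ∧ (∀ j, ∃ i, Equiv (f i) (g j))

theorem Equiv.refl : ∀ x : PreUniverse A, Equiv x x
  | atom _ => rfl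
  | set _ f => ⟨fun i => ⟨i, Equiv.refl (f i)⟩, fun i => ⟨i, Equiv.refl (f i)⟩⟩

theorem Equiv.symm : ∀ {x y : PreUniverse A}, Equiv x y → Equiv y x
  | atom _, atom _, h => Eq.symm h
  | atom _, set _ _, h => h.elim
  | set _ _, atom _, h => h.elim
  | set _ _, set _ _, h =>
      ⟨fun j => (h.2 j).imp fun _ hi => hi.symm, fun i => (h.1 i).imp fun _ hj => hj.symm⟩

theorem Equiv.trans : ∀ {x y z : PreUniverse A}, Equiv x y → Equiv y z → Equiv x z
  | atom _, atom _, atom _, h, k => Eq.trans h k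
  | atom _, atom _, set _ _, _, k => k.elim
  | atom _, set _ _, _, h, _ => h.elim
  | set _ _, atom _, _, h, _ => h.elim
  | set _ _, set _ _, atom _, _, k => k.elim
  | set _ _, set _ _, set _ _, h, k =>
      ⟨fun i => let ⟨j, hj⟩ := h.1 i; let ⟨l, hl⟩ := k.1 j; ⟨l, hj.trans hl⟩,
       fun l => let ⟨j, hj⟩ := k.2 l; let ⟨i, hi⟩ := h.2 j; ⟨i, hi.trans hj⟩⟩

instance setoid (A : Type u) : Setoid (PreUniverse A) :=
  ⟨Equiv, Equiv.refl, Equiv.symm, Equiv.trans⟩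

/-- The object coded by `x` is an element of the object coded by `y`. -/
def Mem (x : PreUniverse A) : PreUniverse A → Prop
  | atom _ => False
  | set _ f => ∃ i, Equiv x (f i)

theorem Mem.congr : ∀ {x x' y y' : PreUniverse A}, Equiv x x' → Equiv y y' → Mem x y → Mem x' y'
  | _, _, atom _, _, _, _, h => h.elim
  | _, _, set _ _, atom _, _, k, _ => k.elim
  | _, _, set _ _, set _ _, e, k, ⟨i, hi⟩ =>
      let ⟨j, hj⟩ := k.1 i; ⟨j, (e.symm.trans hi).trans hj⟩

/-- Being a code for an atom. -/
def IsAtom : PreUniverse A → Prop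
  | atom _ => True
  | set _ _ => False

theorem IsAtom.congr : ∀ {x y : PreUniverse A}, Equiv x y → IsAtom x → IsAtom y
  | atom _, atom _, _, _ => trivial
  | atom _, set _ _, h, _ => h.elim
  | set _ _, _, _, k => k.elim

/-- The action of a permutation of the atoms: `π x = {π y : y ∈ x}` for a set `x`. -/
def map (π : _root_.Equiv.Perm A) : PreUniverse A → PreUniverse A
  | atom a => atom (π a)
  | set ι f => set ι fun i => map π (f i)

theorem map_congr (π : _root_.Equiv.Perm A) :
    ∀ {x y : PreUniverse A}, Equiv x y → Equiv (map π x) (map π y)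
  | atom _, atom _, h => congrArg π h
  | atom _, set _ _, h => h.elim
  | set _ _, atom _, h => h.elim
  | set _ _, set _ _, h =>
      ⟨fun i => (h.1 i).imp fun _ hj => map_congr π hj,
       fun j => (h.2 j).imp fun _ hi => map_congr π hi⟩

theorem map_one : ∀ x : PreUniverse A, map 1 x = x
  | atom _ => rfl
  | set ι f => congrArg (set ι) (funext fun i => map_one (f i))

theorem map_mul (π ρ : _root_.Equiv.Perm A) :
    ∀ x : PreUniverse A, map (π * ρ) x = map π (map ρ x)
  | atom _ => rfl
  | set ι f => congrArg (set ι) (funext fun i => map_mul π ρ (f i))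

end PreUniverse

/-- The universe of all sets over the set `A` of atoms, a model of `ZFA` with the axiom of choice. -/
def Universe (A : Type u) : Type (u + 1) := Quotient (PreUniverse.setoid A)

namespace Universe

variable {A : Type u}

instance : SetStructure (Universe A) where
  mem y x := Quotient.liftOn₂ x y PreUniverse.Mem fun _ _ _ _ h k =>
    propext ⟨PreUniverse.Mem.congr h k, PreUniverse.Mem.congr h.symm k.symm⟩
  IsAtom x := Quotient.liftOn x PreUniverse.IsAtom fun _ _ h =>
    propext ⟨PreUniverse.IsAtom.congr h, PreUniverse.IsAtom.congr h.symm⟩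

/-- Every permutation of the atoms acts on the universe, by `π x = {π y : y ∈ x}`. -/
instance : MulAction (Equiv.Perm A) (Universe A) where
  smul π := Quotient.map (PreUniverse.map π) fun _ _ h => PreUniverse.map_congr π h
  one_smul x := Quotient.inductionOn x fun y => congrArg _ (PreUniverse.map_one y)
  mul_smul π ρ x := Quotient.inductionOn x fun y => congrArg _ (PreUniverse.map_mul π ρ y)

/-- `t ∈ TC({x})`: `t` is `x`, or an element of `x`, or an element of an element of `x`, etc. -/
def InTransitiveClosure (t x : Universe A) : Prop :=
  Relation.ReflTransGen (fun y z : Universe A => y ∈ z) t x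

end Universe

/-! ### The finite partition model -/

/-- The group of all permutations of `A` that move only finitely many elements. -/
def finitaryPerm (A : Type u) : Subgroup (Equiv.Perm A) where
  carrier := {π | {a | π a ≠ a}.Finite}
  one_mem' := by simp
  mul_mem' := by
    intro π ρ hπ hρ
    refine (Set.Finite.union hπ hρ).subset fun a ha => ?_
    by_contra h
    simp only [Set.mem_union, Set.mem_ofPred_eq, not_or, not_not] at h
    exact ha (by rw [Equiv.Perm.mul_apply, h.2, h.1])
  inv_mem' := by
    intro π hπ
    refine Set.Finite.subset hπ fun a ha h => ha ?_
    rw [Equiv.Perm.inv_eq_iff_eq]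
    exact h.symm

/-- The group of all finitary permutations that map each block of the finite partition `P` onto
itself. -/
def fixPartition {A : Type u} (P : Finpartition (Set.univ : Set A)) :
    Subgroup (finitaryPerm A) where
  carrier := {π | ∀ p ∈ P.parts, (π : Equiv.Perm A) '' p = p}
  one_mem' := by
    intro p _
    simp
  mul_mem' := by
    intro π ρ hπ hρ p hp
    have h : ((π * ρ : finitaryPerm A) : Equiv.Perm A) '' p
        = (π : Equiv.Perm A) '' ((ρ : Equiv.Perm A) '' p) := by
      rw [Set.image_image]
      rfl
    rw [h, hρ p hp, hπ p hp]
  inv_mem' := by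
    intro π hπ p hp
    have h : ((π⁻¹ : finitaryPerm A) : Equiv.Perm A) '' ((π : Equiv.Perm A) '' p) = p := by
      rw [Set.image_image]
      simp
    rwa [hπ p hp] at h

/-- The filter of all subgroups that contain the group `fixPartition P` of a finite partition `P`. -/
def partitionFilter (A : Type u) : Set (Subgroup (finitaryPerm A)) :=
  {H | ∃ P : Finpartition (Set.univ : Set A), fixPartition P ≤ H}

/-- The finite partition model: all `x` such that the symmetry group of each member of the transitive
closure of `{x}` belongs to the filter. -/
def Vfp (A : Type u) : Type (u + 1) :=
  {x : Universe A // ∀ t, Universe.InTransitiveClosure t x →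
    MulAction.stabilizer (finitaryPerm A) t ∈ partitionFilter A}

instance (A : Type u) : SetStructure (Vfp A) where
  mem y x := x.1 ∈ y.1
  IsAtom x := SetStructure.IsAtom x.1

end PermModel

/-! Everything except the poset principles rests on a dichotomy for sets `X` of the model
(`exists_supports_or_injOn`). Either one finite family of subsets of `A` supports all elements of
`X`; then every external subset of `X` lies in the model, and the combinatorial theorems transfer
from the ambient theory with choice. Or `X` contains an injective image of an infinite set of atoms
under a finitely supported map. Refining the family turns the domain into an infinite cell
(`exists_supports_or_cell`), on whose `m`-subsets the fixing group acts transitively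
(`exists_image_eq`); supported colorings of the image are then very rigid.

For the dichotomy, note that `(a b) x = x` is an equivalence relation on atoms `a`, `b`. If `x ∈ X`
is moved by a permutation fixing a support `E` of `X`, some infinite cell of `E` is not contained in
one class. A support of `x` yields an infinite set `p` of equivalent atoms in that cell, and `b` is
taken in the cell outside their class; the map is `a ↦ (a b) x`.

For posets, the key is that finitary permutations have finite order, so an element comparable to its
image under a symmetry of the order is fixed (`smul_eq_of_related`). Hence the orbits under a
support form a poset, and unions of orbits are sets of the model. Solutions found among the orbits
with choice are pulled back.

The axioms of `ZFA` follow from comprehension for small, finitely supported classes (`exists_set`).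
Finiteness is absolute, whereas a set is countable in the model exactly if it is externally
countable and its elements have a common finite support (`isCountable_iff`). -/

namespace PermModel

/-! ### The full universe over `A` and its automorphisms -/

namespace Universe

variable {A : Type u}

/-- The object coded by `x`. -/
def mk (x : PreUniverse A) : Universe A := Quotient.mk _ x

/-- The atom `a`, as an element of the universe. -/
def atom (a : A) : Universe A := mk (.atom a)

theorem isAtom_atom (a : A) : SetStructure.IsAtom (atom a) := trivial

theorem isAtom_iff {x : Universe A} : SetStructure.IsAtom x ↔ ∃ a, x = atom a := by
  refine ⟨?_, fun ⟨a, h⟩ => h ▸ isAtom_atom a⟩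
  induction x using Quotient.inductionOn with
  | h x =>
    cases x with
    | atom a => exact fun _ => ⟨a, rfl⟩
    | set ι f => exact fun h => h.elim

theorem notMem_of_isAtom {x y : Universe A} (hx : SetStructure.IsAtom x) : y ∉ x := by
  obtain ⟨a, rfl⟩ := isAtom_iff.1 hx
  induction y using Quotient.inductionOn with
  | h y => exact fun h => h.elim

theorem mem_mk_set {ι : Type u} {f : ι → PreUniverse A} {y : Universe A} :
    y ∈ mk (.set ι f) ↔ ∃ i, y = mk (f i) := by
  induction y using Quotient.inductionOn with
  | h y => exact exists_congr fun i => (Quotient.eq (r := PreUniverse.setoid A)).symm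

theorem exists_eq_mk_set {x : Universe A} (hx : IsSet x) :
    ∃ (ι : Type u) (f : ι → PreUniverse A), x = mk (.set ι f) := by
  induction x using Quotient.inductionOn with
  | h x =>
    cases x with
    | atom a => exact (hx trivial).elim
    | set ι f => exact ⟨ι, f, rfl⟩

theorem ext {x y : Universe A} (hx : IsSet x) (hy : IsSet y) (h : ∀ z, z ∈ x ↔ z ∈ y) :
    x = y := by
  obtain ⟨ι, f, rfl⟩ := exists_eq_mk_set hx
  obtain ⟨κ, g, rfl⟩ := exists_eq_mk_set hy
  refine Quotient.sound ⟨fun i => ?_, fun j => ?_⟩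
  · obtain ⟨j, hj⟩ := mem_mk_set.1 ((h _).1 (mem_mk_set.2 ⟨i, rfl⟩))
    exact ⟨j, Quotient.exact hj⟩
  · obtain ⟨i, hi⟩ := mem_mk_set.1 ((h _).2 (mem_mk_set.2 ⟨j, rfl⟩))
    exact ⟨i, Quotient.exact hi.symm⟩

/-- Codes are indexed by types in `Type u`, so forming a set amounts to checking `u`-smallness. -/
theorem exists_set (S : Set (Universe A)) [Small.{u} S] :
    ∃ X : Universe A, IsSet X ∧ ∀ z, z ∈ X ↔ z ∈ S := by
  refine ⟨mk (.set (Shrink.{u} S) fun i => ((equivShrink S).symm i).1.out),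
    fun h => h, fun z => mem_mk_set.trans ?_⟩
  have hout (y : Universe A) : mk (Quotient.out y) = y := Quotient.out_eq y
  simp only [hout]
  constructor
  · rintro ⟨i, rfl⟩
    exact ((equivShrink S).symm i).2
  · exact fun h => ⟨equivShrink S ⟨z, h⟩, by simp⟩

instance small_mem (x : Universe A) : Small.{u} {z | z ∈ x} := by
  by_cases hx : IsSet x
  · obtain ⟨ι, f, rfl⟩ := exists_eq_mk_set hx
    have : {z | z ∈ mk (.set ι f)} =
        Set.range fun i => mk (f i) := by
      ext z
      exact mem_mk_set.trans (exists_congr fun i => eq_comm)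
    rw [this]
    infer_instance
  · have : {z | z ∈ x} = ∅ :=
      Set.eq_empty_of_forall_notMem fun z => notMem_of_isAtom (not_not.1 hx)
    rw [this]
    infer_instance

theorem mem_wf : WellFounded fun x y : Universe A => x ∈ y := by
  have key : ∀ x : PreUniverse A,
      Acc (fun x y : Universe A => x ∈ y) (mk x) := by
    intro x
    induction x with
    | atom a => exact ⟨_, fun y hy => (notMem_of_isAtom (isAtom_atom a) hy).elim⟩
    | set ι f ih =>
      refine ⟨_, fun y hy => ?_⟩
      obtain ⟨i, rfl⟩ := mem_mk_set.1 hy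
      exact ih i
  exact ⟨fun x => Quotient.inductionOn x key⟩

theorem isAtom_smul (π : Equiv.Perm A) {x : Universe A} :
    SetStructure.IsAtom (π • x) ↔ SetStructure.IsAtom x := by
  induction x using Quotient.inductionOn with
  | h x => cases x <;> exact Iff.rfl

theorem smul_mem_smul_of_mem (π : Equiv.Perm A) {x y : Universe A} (h : x ∈ y) :
    π • x ∈ π • y := by
  by_cases hy : IsSet y
  · obtain ⟨ι, f, rfl⟩ := exists_eq_mk_set hy
    obtain ⟨i, rfl⟩ := mem_mk_set.1 h
    exact mem_mk_set.2 ⟨i, rfl⟩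
  · exact (notMem_of_isAtom (not_not.1 hy) h).elim

theorem smul_mem_smul (π : Equiv.Perm A) {x y : Universe A} : π • x ∈ π • y ↔ x ∈ y :=
  ⟨fun h => by simpa using smul_mem_smul_of_mem π⁻¹ h, smul_mem_smul_of_mem π⟩

theorem InTransitiveClosure.smul (π : Equiv.Perm A) {t x : Universe A}
    (h : InTransitiveClosure t x) : InTransitiveClosure (π • t) (π • x) := by
  induction h with
  | refl => exact .refl
  | tail _ hyz ih => exact ih.tail (smul_mem_smul_of_mem π hyz)

end Universe

/-! ### Finite supports -/

section Support

variable {A : Type u}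

/-- The finitary permutations that preserve every set of the family `F`. -/
def fixes (F : Set (Set A)) : Subgroup (finitaryPerm A) where
  carrier := {π | ∀ p ∈ F, ∀ a, (π : Equiv.Perm A) a ∈ p ↔ a ∈ p}
  one_mem' := fun p _ a => Iff.rfl
  mul_mem' := fun {π ρ} hπ hρ p hp a => (hπ p hp (ρ.1 a)).trans (hρ p hp a)
  inv_mem' := fun {π} hπ p hp a => by
    have := hπ p hp ((π⁻¹ : finitaryPerm A).1 a)
    simpa using this.symm

theorem fixes_anti {F F' : Set (Set A)} (h : F ⊆ F') : fixes F' ≤ fixes F :=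
  fun _ hπ p hp => hπ p (h hp)

/-- The set of the points that are not separated from `a` by a set of the family `F`. -/
def cell (F : Set (Set A)) (a : A) : Set A := {b | ∀ p ∈ F, b ∈ p ↔ a ∈ p}

theorem mem_cell_self (F : Set (Set A)) (a : A) : a ∈ cell F a := fun _ _ => Iff.rfl

theorem cell_eq {F : Set (Set A)} {a b : A} (h : b ∈ cell F a) : cell F b = cell F a := by
  ext c
  exact forall₂_congr fun p hp => by rw [h p hp]

/-- A cell is determined by the members of `F` that contain its points, and `F` has finitely many
subfamilies. -/
theorem finite_range_cell {F : Set (Set A)} (hF : F.Finite) : (Set.range (cell F)).Finite := by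
  have : Set.range (cell F) ⊆ (fun s : Set (Set A) => {b | ∀ p ∈ F, b ∈ p ↔ p ∈ s}) '' 𝒫 F := by
    rintro _ ⟨a, rfl⟩
    refine ⟨{p ∈ F | a ∈ p}, fun p hp => hp.1, ?_⟩
    ext b
    refine forall₂_congr fun p hp => ?_
    simp [hp]
  exact (hF.finite_subsets.image _).subset this

theorem exists_infinite_inter_cell {p : Set A} (hp : p.Infinite) {F : Set (Set A)}
    (hF : F.Finite) : ∃ c, (p ∩ cell F c).Infinite := by
  by_contra! h
  refine hp (((finite_range_cell hF).biUnion
    (t := fun s => p ∩ s) ?_).subset fun a ha => ?_)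
  · rintro _ ⟨c, rfl⟩
    exact h c
  · exact Set.mem_biUnion ⟨a, rfl⟩ ⟨ha, mem_cell_self F a⟩

theorem mem_fixes_iff_cell {F : Set (Set A)} {π : finitaryPerm A} :
    π ∈ fixes F ↔ ∀ a, (π : Equiv.Perm A) a ∈ cell F a :=
  ⟨fun h a p hp => h p hp a, fun h p hp a => h a p hp⟩

/-- Finite families are easier to enlarge than partitions and define the same filter: the blocks of
a partition form a family, and the cells of a family form a partition. -/
theorem mem_partitionFilter {H : Subgroup (finitaryPerm A)} :
    H ∈ partitionFilter A ↔ ∃ F : Set (Set A), F.Finite ∧ fixes F ≤ H := by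
  classical
  constructor
  · rintro ⟨P, hP⟩
    refine ⟨P.parts, P.parts.finite_toSet, fun π hπ => hP fun p hp => ?_⟩
    ext b
    constructor
    · rintro ⟨a, ha, rfl⟩
      exact (hπ p hp a).2 ha
    · intro hb
      refine ⟨(π : Equiv.Perm A).symm b, ?_, by simp⟩
      have := hπ p hp ((π : Equiv.Perm A).symm b)
      rw [Equiv.apply_symm_apply] at this
      exact this.1 hb
  · rintro ⟨F, hF, hH⟩
    let P : Finpartition (Set.univ : Set A) :=
      { parts := (finite_range_cell hF).toFinset
        supIndep := by
          rw [Finset.supIndep_iff_pairwiseDisjoint]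
          intro p hp q hq hpq
          rw [Finset.mem_coe, Set.Finite.mem_toFinset] at hp hq
          obtain ⟨a, rfl⟩ := hp
          obtain ⟨b, rfl⟩ := hq
          refine Set.disjoint_left.2 fun c (hc : c ∈ cell F a) (hc' : c ∈ cell F b) => hpq ?_
          rw [← cell_eq hc, ← cell_eq hc']
        sup_parts := by
          refine Set.eq_univ_of_forall fun a => ?_
          rw [Finset.sup_id_set_eq_sUnion]
          exact ⟨cell F a, by simp, mem_cell_self F a⟩
        bot_notMem := by
          rw [Set.Finite.mem_toFinset]
          rintro ⟨a, ha⟩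
          exact Set.notMem_empty a (Set.bot_eq_empty (α := A) ▸ ha ▸ mem_cell_self F a) }
    refine ⟨P, fun π hπ => hH (mem_fixes_iff_cell.2 fun a => ?_)⟩
    have h := hπ (cell F a) ((Set.Finite.mem_toFinset _).2 ⟨a, rfl⟩)
    rw [← h]
    exact ⟨a, mem_cell_self F a, rfl⟩

/-- Every finite family of sets can be enlarged so that its finite cells are singletons. -/
theorem exists_finite_cells_subsingleton {F : Set (Set A)} (hF : F.Finite) :
    ∃ F' : Set (Set A), F ⊆ F' ∧ F'.Finite ∧
      ∀ a b, b ∈ cell F' a → b ≠ a → (cell F' a).Infinite := by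
  have hfin : {a | (cell F a).Finite}.Finite := by
    have : {a | (cell F a).Finite} ⊆ ⋃₀ {c ∈ Set.range (cell F) | c.Finite} := fun a ha =>
      ⟨cell F a, ⟨⟨a, rfl⟩, ha⟩, mem_cell_self F a⟩
    exact (((finite_range_cell hF).subset fun _ h => h.1).sUnion fun c hc => hc.2).subset this
  -- Only finitely many points lie in finite cells, so their singletons may be adjoined; the
  -- infinite cells are not cut.
  refine ⟨F ∪ (fun a => {a}) '' {a | (cell F a).Finite}, Set.subset_union_left,
    hF.union (hfin.image _), fun a b hb hba => ?_⟩
  have ha : (cell F a).Infinite := fun ha =>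
    hba ((hb {a} (Or.inr ⟨a, ha, rfl⟩)).2 rfl)
  refine ha.mono fun c hc => ?_
  rintro p (hp | ⟨d, hd, rfl⟩)
  · exact hc p hp
  · have h1 : c ≠ d := by
      rintro rfl
      exact ha (cell_eq hc ▸ hd)
    have h2 : a ≠ d := by
      rintro rfl
      exact ha hd
    simp [h1, h2]

end Support

/-! ### Infinite combinatorics in the ambient theory -/

section Combinatorics

open Set

variable {α : Type v}

/-- Iterated choice of a point and of a smaller set that still has the property `Q`. -/
theorem exists_seq_of_step {β : Type*} {Q : Set α → Prop} {R : α → Set α → β → Prop}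
    (step : ∀ W, Q W → ∃ a ∈ W, ∃ W' ⊆ W, Q W' ∧ a ∉ W' ∧ ∃ k, R a W' k) {S : Set α} (hS : Q S) :
    ∃ (a : ℕ → α) (W : ℕ → Set α) (k : ℕ → β), Function.Injective a ∧ (∀ n, a n ∈ S) ∧
      (∀ m n, m < n → a n ∈ W m) ∧ ∀ n, R (a n) (W n) (k n) := by
  obtain ⟨⟨a₀⟩, ⟨k₀⟩⟩ : Nonempty α ∧ Nonempty β := by
    obtain ⟨a, _, _, _, _, _, k, _⟩ := step S hS
    exact ⟨⟨a⟩, ⟨k⟩⟩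
  have : Inhabited α := ⟨a₀⟩
  have : Inhabited β := ⟨k₀⟩
  choose! a ha W hWs hWQ haW k hk using step
  -- The sets decrease, so later points lie in all earlier sets; none repeats because each point is
  -- left out of the next set.
  let T : ℕ → Set α := fun n => W^[n] S
  have hT : ∀ n, T (n + 1) = W (T n) := fun n => Function.iterate_succ_apply' W n S
  have hQ : ∀ n, Q (T n) := by
    intro n
    induction n with
    | zero => exact hS
    | succ n ih => rw [hT]; exact hWQ _ ih
  have hanti : Antitone T := antitone_nat_of_succ_le fun n => by rw [hT]; exact hWs _ (hQ n)
  have hlt : ∀ m n, m < n → a (T n) ∈ W (T m) := fun m n h => by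
    rw [← hT]
    exact hanti (Nat.succ_le_of_lt h) (ha _ (hQ n))
  refine ⟨fun n => a (T n), fun n => W (T n), fun n => k (T n), ?_, fun n => ?_, hlt,
    fun n => hk _ (hQ n)⟩
  · have hne : ∀ m n, m < n → a (T m) ≠ a (T n) := fun m n h e => haW _ (hQ m) (by
      have := hlt m n h
      rwa [← e] at this)
    intro m n e
    by_contra h
    rcases Nat.lt_or_gt_of_ne h with h | h
    · exact hne m n h e
    · exact hne n m h e.symm
  · exact hanti (Nat.zero_le n) (ha _ (hQ n))

/-- Ramsey's theorem for colorings of finite sets of size `m`. -/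
theorem ramsey {κ : Type*} [Finite κ] (m : ℕ) (c : Finset α → κ) {S : Set α} (hS : S.Infinite) :
    ∃ H ⊆ S, H.Infinite ∧ ∃ k, ∀ s : Finset α, ↑s ⊆ H → s.card = m → c s = k := by
  classical
  induction m generalizing c S with
  | zero =>
    refine ⟨S, Subset.rfl, hS, c ∅, fun s _ hs => ?_⟩
    rw [Finset.card_eq_zero.1 hs]
  | succ m ih =>
    -- The color of an `(m + 1)`-set of chosen points will depend only on its first point, which
    -- leaves a pigeonhole argument on the colors `k`.
    obtain ⟨a, W, k, hinj, haS, hlt, hR⟩ := exists_seq_of_step (Q := Set.Infinite)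
      (R := fun a W (k : κ) => ∀ s : Finset α, ↑s ⊆ W → s.card = m → c (insert a s) = k)
      (fun W hW => by
        obtain ⟨a, ha⟩ := hW.nonempty
        obtain ⟨H, hHW, hH, k, hk⟩ := ih (fun s => c (insert a s))
          (hW.sdiff (Set.finite_singleton a))
        exact ⟨a, ha, H, hHW.trans sdiff_subset, hH, fun h => (hHW h).2 rfl, k, hk⟩) hS
    obtain ⟨k₀, hk₀⟩ := Finite.exists_infinite_fiber k
    rw [Set.infinite_coe_iff] at hk₀
    refine ⟨a '' (k ⁻¹' {k₀}), ?_, hk₀.image hinj.injOn, k₀, fun s hs hcard => ?_⟩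
    · rintro _ ⟨n, _, rfl⟩
      exact haS n
    · obtain ⟨t, htk, rfl⟩ := Finset.subset_set_image_iff.1 hs
      have hne : t.Nonempty := by
        rw [Finset.nonempty_iff_ne_empty]
        rintro rfl
        simp at hcard
      have hmin := t.min'_mem hne
      set i := t.min' hne
      have hins : t.image a = insert (a i) ((t.erase i).image a) := by
        rw [← Finset.image_insert, Finset.insert_erase hmin]
      rw [Finset.card_image_of_injective _ hinj] at hcard
      rw [hins, hR i _ ?_ ?_]
      · exact htk hmin
      · intro x hx
        obtain ⟨j, hj, rfl⟩ := Finset.mem_image.1 (Finset.mem_coe.1 hx)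
        exact hlt i j (lt_of_le_of_ne (t.min'_le j (Finset.mem_of_mem_erase hj))
          (Finset.ne_of_mem_erase hj).symm)
      · rw [Finset.card_image_of_injective _ hinj, Finset.card_erase_of_mem hmin, hcard]
        rfl

/-- The rainbow Ramsey theorem for colorings of finite sets of size `m`. -/
theorem rainbow_ramsey {κ : Type*} (m n : ℕ) (c : Finset α → κ) {S : Set α} (hS : S.Infinite)
    (hc : ∀ k, {s : Finset α | ↑s ⊆ S ∧ s.card = m ∧ c s = k}.encard ≤ n) :
    ∃ H ⊆ S, H.Infinite ∧ ∀ s t : Finset α, ↑s ⊆ H → ↑t ⊆ H → s.card = m → t.card = m →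
      c s = c t → s = t := by
  -- Each color class is numbered injectively. On a homogeneous set for the numbering all `m`-sets
  -- have the same number, so no two share a color. The `+ 1` keeps the numbers nonempty when `n =
  -- 0`.
  have hex : ∀ k, ∃ f : Finset α → Fin (n + 1),
      InjOn f {s : Finset α | ↑s ⊆ S ∧ s.card = m ∧ c s = k} := by
    intro k
    have hfin : {s : Finset α | ↑s ⊆ S ∧ s.card = m ∧ c s = k}.Finite :=
      Set.finite_of_encard_le_coe (hc k)
    obtain ⟨f, -, hf⟩ := hfin.exists_injOn_of_encard_le
      (t := (Set.univ : Set (Fin (n + 1)))) ((hc k).trans (by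
        rw [Set.encard_univ, ENat.card_eq_coe_fintype_card, Fintype.card_fin]
        exact_mod_cast Nat.le_succ n))
    exact ⟨f, hf⟩
  choose f hf using hex
  obtain ⟨H, hHS, hH, k, hk⟩ := ramsey m (fun s => f (c s) s) hS
  refine ⟨H, hHS, hH, fun s t hs ht hsm htm hst => ?_⟩
  refine hf (c s) ⟨hs.trans hHS, hsm, rfl⟩ ⟨ht.trans hHS, htm, hst.symm⟩ ?_
  have h1 := hk s hs hsm
  have h2 := hk t ht htm
  simp only [← hst] at h2
  exact h1.trans h2.symm

/-- A symmetric relation on an uncountable set has an uncountable independent set or an infinite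
clique. -/
theorem exists_uncountable_independent_or_infinite_clique (r : α → α → Prop)
    (hr : ∀ x y, r x y → r y x) {S : Set α} (hS : ¬ S.Countable) :
    (∃ Y ⊆ S, ¬ Y.Countable ∧ Y.Pairwise fun x y => ¬ r x y) ∨
      ∃ Y ⊆ S, Y.Infinite ∧ Y.Pairwise r := by
  refine or_iff_not_imp_left.2 fun hind => ?_
  have step : ∀ W, (W ⊆ S ∧ ¬ W.Countable) →
      ∃ a ∈ W, ∃ W' ⊆ W, (W' ⊆ S ∧ ¬ W'.Countable) ∧ a ∉ W' ∧ ∃ _ : Unit, ∀ b ∈ W', r a b := by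
    rintro W ⟨hWS, hW⟩
    by_contra! hcon
    -- If every point had only countably many neighbours in `W`, then `W` would be covered by a
    -- countable maximal independent set and the neighbours of its points.
    have hnb : ∀ a ∈ W, {b ∈ W | r a b}.Countable := by
      intro a ha
      by_contra hun
      obtain ⟨b, hb, hbr⟩ := hcon a ha ({b ∈ W | r a b} \ {a}) (fun b hb => hb.1.1)
        ⟨fun b hb => hWS hb.1.1, fun h => hun ((h.union (countable_singleton a)).mono
          fun b hb => by by_cases h : b = a <;> simp_all)⟩ (fun h => h.2 rfl) ()
      exact hbr hb.1.2
    obtain ⟨I, -, hI⟩ := zorn_subset_nonempty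
      {I : Set α | I ⊆ W ∧ I.Pairwise fun x y => ¬ r x y}
      (fun c hc hchain _ => ⟨⋃₀ c, ⟨sUnion_subset fun s hs => (hc hs).1,
        (pairwise_sUnion hchain.directedOn).2 fun s hs => (hc hs).2⟩,
        fun s hs => subset_sUnion_of_mem hs⟩) ∅ ⟨empty_subset _, pairwise_empty _⟩
    have hIc : I.Countable := by
      by_contra h
      exact hind ⟨I, hI.prop.1.trans hWS, h, hI.prop.2⟩
    refine hW ((hIc.union (hIc.biUnion fun a ha => hnb a (hI.prop.1 ha))).mono fun b hb => ?_)
    by_contra hbn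
    simp only [mem_union, mem_iUnion, mem_sep_iff, not_or, not_exists, not_and] at hbn
    refine hbn.1 (hI.le_of_ge (y := insert b I) ⟨insert_subset hb hI.prop.1, ?_⟩
      (subset_insert b I) (mem_insert b I))
    refine hI.prop.2.insert fun a ha _ => ?_
    exact ⟨fun h => hbn.2 a ha hb (hr _ _ h), hbn.2 a ha hb⟩
  obtain ⟨a, W, -, hinj, haS, hlt, hR⟩ := exists_seq_of_step step ⟨Subset.rfl, hS⟩
  refine ⟨range a, range_subset_iff.2 haS, infinite_range_of_injective hinj, ?_⟩
  rintro _ ⟨m, rfl⟩ _ ⟨n, rfl⟩ hne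
  rcases lt_trichotomy m n with h | rfl | h
  · exact hR m _ (hlt m n h)
  · exact (hne rfl).elim
  · exact hr _ _ (hR n _ (hlt n m h))

open Cardinal in
/-- If every set of the family has at least as many elements as the family has members, then the
family has an injective choice function. -/
theorem exists_injective_choice {ι : Type v} [Infinite ι] (T : ι → Set α)
    (hT : ∀ i, #ι ≤ #(T i)) : ∃ f : ι → α, Function.Injective f ∧ ∀ i, f i ∈ T i := by
  -- In a well-order of least type each index has fewer than `#ι` predecessors, so the values chosen
  -- before `i` cannot exhaust `T i`.
  obtain ⟨r, wo, hr⟩ := Cardinal.exists_ord_eq ι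
  have hex : ∀ (i : ι) (g : ∀ j, r j i → α), ∃ x ∈ T i, ∀ j (h : r j i), g j h ≠ x := by
    intro i g
    have hlt : #(range fun j : {j // r j i} => g j.1 j.2) < #(T i) := by
      refine lt_of_le_of_lt mk_range_le (lt_of_lt_of_le ?_ (hT i))
      exact Cardinal.card_typein_lt i hr
    by_contra! hcon
    refine absurd (mk_le_mk_of_subset (s := T i) fun x hx => ?_) (not_le.2 hlt)
    obtain ⟨j, h, e⟩ := hcon x hx
    exact ⟨⟨j, h⟩, e⟩
  choose F hF hF' using hex
  let f : ι → α := wo.wf.fix F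
  have hf : ∀ i, f i = F i fun j _ => f j := fun i => wo.wf.fix_eq F i
  refine ⟨f, fun i j hij => ?_, fun i => by rw [hf]; exact hF _ _⟩
  rcases trichotomous_of r i j with h | h | h
  · refine (hF' j (fun k _ => f k) i h ?_).elim
    rw [← hf, hij]
  · exact h
  · refine (hF' i (fun k _ => f k) j h ?_).elim
    rw [← hf, hij]

open Cardinal in
/-- Every poset without maximal elements has two disjoint cofinal subsets. -/
theorem exists_disjoint_cofinal [PartialOrder α] [NoMaxOrder α] :
    ∃ C D : Set α, Disjoint C D ∧ (∀ x, ∃ c ∈ C, x ≤ c) ∧ ∀ x, ∃ d ∈ D, x ≤ d := by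
  have good : ∀ p : α, ∃ q ≥ p, ∃ C D : Set α, Disjoint C D ∧ C ⊆ Ici q ∧ D ⊆ Ici q ∧
      (∀ x ≥ q, ∃ c ∈ C, x ≤ c) ∧ ∀ x ≥ q, ∃ d ∈ D, x ≤ d := by
    intro p
    -- With `Ici q` of least cardinality, every cone above `q` has at least `#(Ici q)` elements, so
    -- two distinct points can be chosen above each `x ≥ q`, injectively overall.
    obtain ⟨q, hqp, hmin⟩ := WellFounded.has_min
      (InvImage.wf (fun q : α => #(Ici q)) Cardinal.lt_wf) (Ici p) ⟨p, le_rfl⟩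
    have hinf : Infinite (Ici q) := inferInstance
    obtain ⟨f, hinj, hf⟩ := exists_injective_choice (ι := Ici q × ULift.{v} Bool)
      (fun i => Ici i.1.1) (fun i => by
        have h1 : #(Ici q × ULift.{v} Bool) = #(Ici q) := by
          rw [mk_prod, lift_id, lift_id]
          exact mul_eq_left (aleph0_le_mk _)
            (le_trans (le_of_lt (lt_aleph0_of_finite _)) (aleph0_le_mk _)) (mk_ne_zero _)
        rw [h1]
        exact not_lt.1 (hmin i.1.1 (le_trans hqp i.1.2)))
    refine ⟨q, hqp, range fun i => f (i, ⟨true⟩), range fun i => f (i, ⟨false⟩), ?_, ?_, ?_,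
      fun x hx => ⟨_, ⟨⟨x, hx⟩, rfl⟩, hf (⟨x, hx⟩, _)⟩,
      fun x hx => ⟨_, ⟨⟨x, hx⟩, rfl⟩, hf (⟨x, hx⟩, _)⟩⟩
    · rw [Set.disjoint_left]
      rintro _ ⟨i, rfl⟩ ⟨j, hj⟩
      simpa using hinj hj
    · rintro _ ⟨i, rfl⟩
      exact le_trans i.2 (mem_Ici.1 (hf (i, _)))
    · rintro _ ⟨i, rfl⟩
      exact le_trans i.2 (mem_Ici.1 (hf (i, _)))
  let g : Set α := {q | ∃ C D : Set α, Disjoint C D ∧ C ⊆ Ici q ∧ D ⊆ Ici q ∧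
      (∀ x ≥ q, ∃ c ∈ C, x ≤ c) ∧ ∀ x ≥ q, ∃ d ∈ D, x ≤ d}
  -- The cones of a maximal family of pairwise incompatible good points are disjoint, and every
  -- point is compatible with one of them; so the pieces glue.
  obtain ⟨I, -, hI⟩ := zorn_subset_nonempty
    {I : Set α | I ⊆ g ∧ I.Pairwise fun x y => ¬ ∃ z, x ≤ z ∧ y ≤ z}
    (fun c hc hchain _ => ⟨⋃₀ c, ⟨sUnion_subset fun s hs => (hc hs).1,
      (pairwise_sUnion hchain.directedOn).2 fun s hs => (hc hs).2⟩,
      fun s hs => subset_sUnion_of_mem hs⟩) ∅ ⟨empty_subset _, pairwise_empty _⟩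
  have hcompat : ∀ x, ∃ q ∈ I, ∃ z, x ≤ z ∧ q ≤ z := by
    intro x
    obtain ⟨q, hq, hqg⟩ := good x
    by_contra! hcon
    have hqI : q ∈ I := by
      refine hI.le_of_ge (y := insert q I) ⟨insert_subset hqg hI.prop.1, ?_⟩
        (subset_insert q I) (mem_insert q I)
      refine hI.prop.2.insert fun a ha _ => ?_
      exact ⟨fun ⟨z, h1, h2⟩ => hcon a ha z (le_trans hq h1) h2,
        fun ⟨z, h1, h2⟩ => hcon a ha z (le_trans hq h2) h1⟩
    exact hcon q hqI q hq le_rfl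
  have hIg : ∀ q ∈ I, q ∈ g := hI.prop.1
  choose! C D hCD hC hD hCc hDc using hIg
  refine ⟨⋃ q ∈ I, C q, ⋃ q ∈ I, D q, ?_, fun x => ?_, fun x => ?_⟩
  · simp only [disjoint_iUnion_left, disjoint_iUnion_right]
    intro q hq p hp
    by_cases hpq : p = q
    · subst hpq
      exact hCD _ hq
    · rw [Set.disjoint_left]
      exact fun z hz hz' => hI.prop.2 hp hq hpq ⟨z, hC p hp hz, hD q hq hz'⟩
  · obtain ⟨q, hq, z, hxz, hqz⟩ := hcompat x
    obtain ⟨c, hc, hzc⟩ := hCc q hq z hqz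
    exact ⟨c, mem_biUnion hq hc, hxz.trans hzc⟩
  · obtain ⟨q, hq, z, hxz, hqz⟩ := hcompat x
    obtain ⟨c, hc, hzc⟩ := hDc q hq z hqz
    exact ⟨c, mem_biUnion hq hc, hxz.trans hzc⟩

end Combinatorics

/-! ### The group action and comprehension in the model -/

namespace Vfp

variable {A : Type u}

/-- Normality of the filter: conjugation by `π` replaces a supporting family by its image under `π`.
Hence the model is closed under the action. -/
theorem mem_stabilizer_filter_smul {t : Universe A} (π : finitaryPerm A)
    (h : MulAction.stabilizer (finitaryPerm A) t ∈ partitionFilter A) :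
    MulAction.stabilizer (finitaryPerm A) (π • t) ∈ partitionFilter A := by
  obtain ⟨F, hF, hFt⟩ := mem_partitionFilter.1 h
  refine mem_partitionFilter.2 ⟨(fun p => (π : Equiv.Perm A) '' p) '' F, hF.image _,
    fun σ hσ => ?_⟩
  have hmem : π⁻¹ * σ * π ∈ fixes F := by
    intro p hp a
    have h1 := hσ _ ⟨p, hp, rfl⟩ ((π : Equiv.Perm A) a)
    simp only [(π : Equiv.Perm A).injective.mem_set_image] at h1
    rw [Equiv.image_eq_preimage_symm] at h1
    exact h1
  have h2 : (π⁻¹ * σ * π) • t = t := hFt hmem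
  rw [MulAction.mem_stabilizer_iff, ← mul_smul]
  rwa [mul_assoc, mul_smul, inv_smul_eq_iff] at h2

/-- The finitary permutations act on the finite partition model. -/
instance : MulAction (finitaryPerm A) (Vfp A) where
  smul π x := ⟨π • x.1, fun t ht => by
    have h1 : Universe.InTransitiveClosure (π⁻¹ • t) x.1 := by
      have := ht.smul (π : Equiv.Perm A)⁻¹
      rwa [Subgroup.smul_def, inv_smul_smul] at this
    have := mem_stabilizer_filter_smul π (x.2 _ h1)
    rwa [smul_inv_smul] at this⟩
  one_smul x := Subtype.ext (one_smul (finitaryPerm A) x.1)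
  mul_smul π ρ x := Subtype.ext (mul_smul π ρ x.1)

/-- Transitivity of the model, which is what extensionality needs. -/
theorem exists_val_eq_of_mem {y : Universe A} {x : Vfp A} (h : y ∈ x.1) :
    ∃ z : Vfp A, z.1 = y :=
  ⟨⟨y, fun t ht => x.2 t (Relation.ReflTransGen.tail ht h)⟩, rfl⟩

theorem ext {x y : Vfp A} (hx : IsSet x) (hy : IsSet y) (h : ∀ z, z ∈ x ↔ z ∈ y) : x = y := by
  refine Subtype.ext (Universe.ext hx hy fun z => ⟨fun hz => ?_, fun hz => ?_⟩)
  · obtain ⟨z, rfl⟩ := exists_val_eq_of_mem hz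
    exact (h z).1 hz
  · obtain ⟨z, rfl⟩ := exists_val_eq_of_mem hz
    exact (h z).2 hz

theorem mem_wf : WellFounded fun x y : Vfp A => x ∈ y :=
  InvImage.wf (fun x : Vfp A => x.1) Universe.mem_wf

theorem notMem_of_isAtom {x y : Vfp A} (hx : SetStructure.IsAtom x) : y ∉ x :=
  Universe.notMem_of_isAtom (x := x.1) hx

instance small_mem (x : Vfp A) : Small.{u} {z | z ∈ x} :=
  small_of_injective (β := {z | z ∈ x.1}) (f := fun z => ⟨z.1.1, z.2⟩) fun _ _ h =>
    Subtype.ext (Subtype.ext (Subtype.mk.inj h))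

theorem small_of_forall_mem {S : Set (Vfp A)} {x : Vfp A} (h : ∀ z ∈ S, z ∈ x) : Small.{u} S :=
  small_subset (t := S) (s := {z | z ∈ x}) h

@[simp]
theorem smul_mem_smul (π : finitaryPerm A) {x y : Vfp A} : π • x ∈ π • y ↔ x ∈ y :=
  Universe.smul_mem_smul (π : Equiv.Perm A) (x := x.1) (y := y.1)

theorem isAtom_smul (π : finitaryPerm A) {x : Vfp A} :
    SetStructure.IsAtom (π • x) ↔ SetStructure.IsAtom x :=
  Universe.isAtom_smul (π : Equiv.Perm A) (x := x.1)

@[simp]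
theorem isSet_smul (π : finitaryPerm A) {x : Vfp A} : IsSet (π • x) ↔ IsSet x :=
  not_congr (isAtom_smul π)

theorem mem_smul_iff (π : finitaryPerm A) {x y : Vfp A} : y ∈ π • x ↔ π⁻¹ • y ∈ x := by
  rw [← smul_mem_smul π (x := π⁻¹ • y), smul_inv_smul]

/-- The family `F` supports `x`. -/
def Supports (F : Set (Set A)) (x : Vfp A) : Prop := ∀ π ∈ fixes F, π • x = x

theorem Supports.mono {F F' : Set (Set A)} {x : Vfp A} (h : Supports F x) (hF : F ⊆ F') :
    Supports F' x := fun π hπ => h π (fixes_anti hF hπ)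

theorem exists_supports (x : Vfp A) : ∃ F : Set (Set A), F.Finite ∧ Supports F x := by
  obtain ⟨F, hF, h⟩ := mem_partitionFilter.1 (x.2 x.1 Relation.ReflTransGen.refl)
  exact ⟨F, hF, fun π hπ => Subtype.ext (h hπ)⟩

theorem exists_supports_of_finite {S : Set (Vfp A)} (hS : S.Finite) :
    ∃ F : Set (Set A), F.Finite ∧ ∀ x ∈ S, Supports F x := by
  choose F hF h using exists_supports (A := A)
  exact ⟨⋃ x ∈ S, F x, hS.biUnion fun x _ => hF x,
    fun x hx => (h x).mono (Set.subset_biUnion_of_mem hx)⟩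

theorem Supports.smul_mem_iff {F : Set (Set A)} {x y : Vfp A} {π : finitaryPerm A}
    (h : Supports F x) (hπ : π ∈ fixes F) : π • y ∈ x ↔ y ∈ x := by
  conv_lhs => rw [← h π hπ]
  exact smul_mem_smul π

/-- Comprehension in the finite partition model: every small class that has a finite support is a
set. -/
theorem exists_set (S : Set (Vfp A)) [Small.{u} S] {F : Set (Set A)} (hF : F.Finite)
    (hS : ∀ π ∈ fixes F, ∀ x ∈ S, π • x ∈ S) : ∃ X : Vfp A, IsSet X ∧ ∀ z, z ∈ X ↔ z ∈ S := by
  obtain ⟨X, hX, hmem⟩ := Universe.exists_set ((fun x : Vfp A => x.1) '' S)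
  have hfix : ∀ π ∈ fixes F, π • X = X := by
    have hsub : ∀ π ∈ fixes F, ∀ z ∈ X, π • z ∈ X := by
      intro π hπ z hz
      obtain ⟨y, hy, rfl⟩ := (hmem z).1 hz
      exact (hmem _).2 ⟨_, hS π hπ y hy, rfl⟩
    intro π hπ
    refine Universe.ext ((not_congr (Universe.isAtom_smul (π : Equiv.Perm A))).2 hX) hX
      fun z => ⟨fun hz => ?_, fun hz => ?_⟩
    · have h1 := Universe.smul_mem_smul_of_mem ((π : Equiv.Perm A)⁻¹) hz
      rw [Subgroup.smul_def, inv_smul_smul] at h1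
      have h2 := hsub π hπ _ h1
      rwa [Subgroup.smul_def, smul_inv_smul] at h2
    · have h1 := Universe.smul_mem_smul_of_mem (π : Equiv.Perm A) (hsub π⁻¹ (inv_mem hπ) z hz)
      rw [show (π : Equiv.Perm A) • π⁻¹ • z = z from smul_inv_smul π z] at h1
      exact h1
  refine ⟨⟨X, fun t ht => ?_⟩, hX, fun z => ?_⟩
  · rcases Relation.ReflTransGen.cases_tail ht with rfl | ⟨y, hty, hyX⟩
    · exact mem_partitionFilter.2 ⟨F, hF, hfix⟩
    · obtain ⟨y, hy, rfl⟩ := (hmem y).1 hyX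
      exact y.2 t hty
  · refine (hmem z.1).trans ⟨?_, fun h => ⟨z, h, rfl⟩⟩
    rintro ⟨y, hy, hyz⟩
    rwa [← Subtype.ext hyz]

/-- Separation in the finite partition model for finitely supported classes. -/
theorem exists_subset (X : Vfp A) (S : Set (Vfp A)) {F : Set (Set A)} (hF : F.Finite)
    (hX : Supports F X) (hS : ∀ π ∈ fixes F, ∀ x ∈ X, x ∈ S → π • x ∈ S) :
    ∃ Y : Vfp A, IsSet Y ∧ ∀ z, z ∈ Y ↔ z ∈ X ∧ z ∈ S := by
  have : Small.{u} {z | z ∈ X ∧ z ∈ S} := small_of_forall_mem fun z hz => hz.1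
  exact exists_set {z | z ∈ X ∧ z ∈ S} hF fun π hπ x hx =>
    ⟨(hX.smul_mem_iff hπ).2 hx.1, hS π hπ x hx.1 hx.2⟩

/-- A small class whose elements have a common finite support is a set. -/
theorem exists_set_of_supports (S : Set (Vfp A)) [Small.{u} S] {F : Set (Set A)} (hF : F.Finite)
    (hS : ∀ x ∈ S, Supports F x) : ∃ X : Vfp A, IsSet X ∧ ∀ z, z ∈ X ↔ z ∈ S :=
  exists_set S hF fun π hπ x hx => by rwa [hS x hx π hπ]

theorem exists_set_of_finite {S : Set (Vfp A)} (hS : S.Finite) :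
    ∃ X : Vfp A, IsSet X ∧ ∀ z, z ∈ X ↔ z ∈ S := by
  obtain ⟨F, hF, h⟩ := exists_supports_of_finite hS
  have := hS.to_subtype
  exact exists_set_of_supports S hF h

instance : Nonempty (Vfp A) := ⟨(exists_set_of_finite (A := A) Set.finite_empty).choose⟩

/-- The atom `a`, as an element of the finite partition model. -/
theorem exists_atom (a : A) : ∃ x : Vfp A, x.1 = Universe.atom a := by
  refine ⟨⟨Universe.atom a, fun t ht => ?_⟩, rfl⟩
  rcases Relation.ReflTransGen.cases_tail ht with rfl | ⟨y, -, hy⟩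
  · refine mem_partitionFilter.2 ⟨{{a}}, Set.finite_singleton _, fun π hπ => ?_⟩
    exact congrArg Universe.atom ((hπ {a} rfl a).2 rfl)
  · exact (Universe.notMem_of_isAtom (Universe.isAtom_atom a) hy).elim

/-! ### Pairs, relations and functions in the finite partition model -/

theorem exists_isPair (a b : Vfp A) : ∃ p, IsPair p a b :=
  exists_set_of_finite (Set.toFinite {a, b})

/-- The unordered pair `{a, b}`. -/
noncomputable def pair (a b : Vfp A) : Vfp A := (exists_isPair a b).choose

theorem isPair_pair (a b : Vfp A) : IsPair (pair a b) a b := (exists_isPair a b).choose_spec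

theorem mem_pair {a b z : Vfp A} : z ∈ pair a b ↔ z = a ∨ z = b := (isPair_pair a b).2 z

theorem isPair_iff {p a b : Vfp A} : IsPair p a b ↔ p = pair a b := by
  refine ⟨fun h => ext h.1 (isPair_pair a b).1 fun z => ?_, fun h => h ▸ isPair_pair a b⟩
  rw [h.2, mem_pair]

/-- The ordered pair `(a, b)`. -/
noncomputable def opair (a b : Vfp A) : Vfp A := pair (pair a a) (pair a b)

theorem isOrderedPair_iff {p a b : Vfp A} : IsOrderedPair p a b ↔ p = opair a b := by
  simp only [IsOrderedPair, isPair_iff]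
  exact ⟨by rintro ⟨_, _, rfl, rfl, rfl⟩; rfl, by rintro rfl; exact ⟨_, _, rfl, rfl, rfl⟩⟩

theorem pair_eq_pair {a b c d : Vfp A} (h : pair a b = pair c d) :
    a = c ∧ b = d ∨ a = d ∧ b = c := by
  have ha : a = c ∨ a = d := mem_pair.1 (h ▸ mem_pair.2 (Or.inl rfl))
  have hb : b = c ∨ b = d := mem_pair.1 (h ▸ mem_pair.2 (Or.inr rfl))
  have hc : c = a ∨ c = b := mem_pair.1 (h ▸ mem_pair.2 (Or.inl rfl))
  have hd : d = a ∨ d = b := mem_pair.1 (h ▸ mem_pair.2 (Or.inr rfl))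
  grind

theorem opair_inj {a b c d : Vfp A} : opair a b = opair c d ↔ a = c ∧ b = d := by
  refine ⟨fun h => ?_, by rintro ⟨rfl, rfl⟩; rfl⟩
  rcases pair_eq_pair h with ⟨h1, h2⟩ | ⟨h1, h2⟩
  · have h1 := pair_eq_pair h1
    have h2 := pair_eq_pair h2
    grind
  · have h1 := pair_eq_pair h1
    have h2 := pair_eq_pair h2
    grind

theorem smul_pair (π : finitaryPerm A) (a b : Vfp A) : π • pair a b = pair (π • a) (π • b) := by
  refine ext ((isSet_smul π).2 (isPair_pair a b).1) (isPair_pair _ _).1 fun z => ?_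
  rw [mem_smul_iff, mem_pair, mem_pair, inv_smul_eq_iff, inv_smul_eq_iff]

theorem smul_opair (π : finitaryPerm A) (a b : Vfp A) :
    π • opair a b = opair (π • a) (π • b) := by
  simp only [opair, smul_pair]

theorem related_iff {f x y : Vfp A} : Related f x y ↔ opair x y ∈ f := by
  simp only [Related, isOrderedPair_iff, exists_eq_left]

theorem Supports.related_smul {F : Set (Set A)} {f x y : Vfp A} {π : finitaryPerm A}
    (h : Supports F f) (hπ : π ∈ fixes F) :
    Related f (π • x) (π • y) ↔ Related f x y := by
  rw [related_iff, related_iff, ← smul_opair, h.smul_mem_iff hπ]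

theorem _root_.PermModel.IsRelation.mem_of_related {r X Y x y : Vfp A} (hr : IsRelation r X Y)
    (h : Related r x y) : x ∈ X ∧ y ∈ Y := by
  obtain ⟨x', y', hx', hy', hp⟩ := hr.2 _ (related_iff.1 h)
  rw [isOrderedPair_iff, opair_inj] at hp
  exact ⟨hp.1 ▸ hx', hp.2 ▸ hy'⟩

/-- Reduces the construction of relations in the model to a check of equivariance; smallness comes
from the product of `X` and `Y`. -/
theorem exists_relation {X Y : Vfp A} (r : Vfp A → Vfp A → Prop) {F : Set (Set A)}
    (hF : F.Finite) (hX : Supports F X) (hY : Supports F Y)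
    (hr : ∀ π ∈ fixes F, ∀ x ∈ X, ∀ y ∈ Y, r x y → r (π • x) (π • y)) :
    ∃ f : Vfp A, IsRelation f X Y ∧ ∀ x y, Related f x y ↔ x ∈ X ∧ y ∈ Y ∧ r x y := by
  have hsub : {p : Vfp A | ∃ x y, x ∈ X ∧ y ∈ Y ∧ r x y ∧ p = opair x y} ⊆
      Set.range fun z : {x | x ∈ X} × {y | y ∈ Y} => opair z.1.1 z.2.1 := by
    rintro p ⟨x, y, hx, hy, -, rfl⟩
    exact ⟨(⟨x, hx⟩, ⟨y, hy⟩), rfl⟩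
  have := small_subset.{u} hsub
  obtain ⟨f, hf, hmem⟩ := exists_set {p : Vfp A | ∃ x y, x ∈ X ∧ y ∈ Y ∧ r x y ∧
    p = opair x y} hF (by
      rintro π hπ _ ⟨x, y, hx, hy, hxy, rfl⟩
      exact ⟨π • x, π • y, (hX.smul_mem_iff hπ).2 hx, (hY.smul_mem_iff hπ).2 hy,
        hr π hπ x hx y hy hxy, smul_opair π x y⟩)
  refine ⟨f, ⟨hf, fun p hp => ?_⟩, fun x y => ?_⟩
  · obtain ⟨x, y, hx, hy, -, rfl⟩ := (hmem p).1 hp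
    exact ⟨x, y, hx, hy, isOrderedPair_iff.2 rfl⟩
  · rw [related_iff, hmem]
    constructor
    · rintro ⟨x', y', hx, hy, hr, h⟩
      obtain ⟨rfl, rfl⟩ := opair_inj.1 h
      exact ⟨hx, hy, hr⟩
    · rintro ⟨hx, hy, hr⟩
      exact ⟨x, y, hx, hy, hr, rfl⟩

theorem exists_injection {X Y : Vfp A} (g : Vfp A → Vfp A) {F : Set (Set A)} (hF : F.Finite)
    (hX : Supports F X) (hY : Supports F Y) (hg : ∀ x ∈ X, g x ∈ Y)
    (hinj : ∀ x ∈ X, ∀ y ∈ X, g x = g y → x = y)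
    (hequiv : ∀ π ∈ fixes F, ∀ x ∈ X, g (π • x) = π • g x) :
    ∃ f : Vfp A, IsInjection f X Y ∧ ∀ x ∈ X, Related f x (g x) := by
  obtain ⟨f, hf, hrel⟩ := exists_relation (X := X) (Y := Y) (fun x y => y = g x) hF hX hY
    (by rintro π hπ x hx _ - rfl; exact (hequiv π hπ x hx).symm)
  refine ⟨f, ⟨⟨hf, fun x hx => ⟨g x, (hrel _ _).2 ⟨hx, hg x hx, rfl⟩, fun y hy => ?_⟩⟩,
    fun x x' y h h' => ?_⟩, fun x hx => (hrel _ _).2 ⟨hx, hg x hx, rfl⟩⟩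
  · exact ((hrel _ _).1 hy).2.2
  · rw [hrel] at h h'
    exact hinj x h.1 x' h'.1 (h.2.2.symm.trans h'.2.2)

theorem _root_.PermModel.IsInjection.exists_map {f X Y : Vfp A} (hf : IsInjection f X Y) :
    ∃ g : Vfp A → Vfp A, (∀ x ∈ X, Related f x (g x)) ∧ (∀ x ∈ X, g x ∈ Y) ∧
      Set.InjOn g {x | x ∈ X} := by
  choose! g hg _ using hf.1.2
  refine ⟨g, hg, fun x hx => (hf.1.1.mem_of_related (hg x hx)).2, fun x hx y hy h => ?_⟩
  refine hf.2 x y (g x) (hg x hx) ?_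
  rw [h]
  exact hg y hy

/-! ### Numerals, finite and countable sets -/

theorem exists_isEmptySet : ∃ x : Vfp A, IsEmptySet x := by
  obtain ⟨x, hx, h⟩ := exists_set_of_finite (A := A) Set.finite_empty
  exact ⟨x, hx, fun z hz => (h z).1 hz⟩

theorem exists_isSucc (x : Vfp A) : ∃ y, IsSucc y x := by
  obtain ⟨F, hF, hx⟩ := exists_supports x
  have : {z | z ∈ x ∨ z = x} = {z | z ∈ x} ∪ {x} := rfl
  have : Small.{u} {z | z ∈ x ∨ z = x} := by
    rw [this]
    infer_instance
  refine exists_set {z | z ∈ x ∨ z = x} hF fun π hπ z hz => hz.imp ?_ ?_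
  · exact (hx.smul_mem_iff hπ).2
  · rintro rfl
    exact hx π hπ

/-- The `n`-th von Neumann numeral. -/
noncomputable def num : ℕ → Vfp A
  | 0 => exists_isEmptySet.choose
  | n + 1 => (exists_isSucc (num n)).choose

theorem isEmptySet_num_zero : IsEmptySet (num 0 : Vfp A) := exists_isEmptySet.choose_spec

theorem isSucc_num_succ (n : ℕ) : IsSucc (num (n + 1) : Vfp A) (num n) :=
  (exists_isSucc (num n)).choose_spec

theorem isSet_num (n : ℕ) : IsSet (num n : Vfp A) := by
  cases n with
  | zero => exact isEmptySet_num_zero.1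
  | succ n => exact (isSucc_num_succ n).1

theorem isEmptySet_iff {x : Vfp A} : IsEmptySet x ↔ x = num 0 := by
  refine ⟨fun h => ext h.1 (isSet_num 0) fun z => ?_, fun h => h ▸ isEmptySet_num_zero⟩
  exact iff_of_false (h.2 z) (isEmptySet_num_zero.2 z)

theorem isSucc_num_iff {x : Vfp A} {n : ℕ} : IsSucc x (num n) ↔ x = num (n + 1) := by
  refine ⟨fun h => ext h.1 (isSet_num _) fun z => ?_, fun h => h ▸ isSucc_num_succ n⟩
  rw [h.2, (isSucc_num_succ n).2]

theorem isNumeral_iff {n : ℕ} {x : Vfp A} : IsNumeral n x ↔ x = num n := by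
  induction n generalizing x with
  | zero => exact isEmptySet_iff
  | succ n ih =>
    simp only [IsNumeral, ih, exists_eq_left]
    exact isSucc_num_iff

theorem mem_num {n : ℕ} {z : Vfp A} : z ∈ (num n : Vfp A) ↔ ∃ k < n, z = num k := by
  induction n with
  | zero => simp [isEmptySet_num_zero.2 z]
  | succ n ih =>
    rw [(isSucc_num_succ n).2, ih]
    constructor
    · rintro (⟨k, hk, rfl⟩ | rfl)
      · exact ⟨k, by omega, rfl⟩
      · exact ⟨n, by omega, rfl⟩
    · rintro ⟨k, hk, rfl⟩
      rcases Nat.lt_succ_iff_lt_or_eq.1 hk with hk | rfl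
      · exact Or.inl ⟨k, hk, rfl⟩
      · exact Or.inr rfl

theorem num_injective : Function.Injective (num : ℕ → Vfp A) := by
  have hne : ∀ m n : ℕ, m < n → (num m : Vfp A) ≠ num n := fun m n h e => by
    have hmem : (num m : Vfp A) ∈ num n := mem_num.2 ⟨m, h, rfl⟩
    rw [e] at hmem
    exact mem_wf.asymmetric _ _ hmem hmem
  intro m n e
  by_contra h
  rcases Nat.lt_or_gt_of_ne h with h | h
  · exact hne m n h e
  · exact hne n m h e.symm

@[simp]
theorem smul_num (π : finitaryPerm A) (n : ℕ) : π • (num n : Vfp A) = num n := by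
  induction n using Nat.strong_induction_on with
  | _ n ih =>
    refine ext ((isSet_smul π).2 (isSet_num n)) (isSet_num n) fun z => ?_
    rw [mem_smul_iff, mem_num, mem_num]
    refine exists_congr fun k => and_congr_right fun hk => ?_
    rw [inv_smul_eq_iff, ih k hk]

theorem supports_num (F : Set (Set A)) (n : ℕ) : Supports F (num n) := fun π _ => smul_num π n

theorem exists_isOmega :
    ∃ w : Vfp A, IsOmega w ∧ (∀ z, z ∈ w ↔ ∃ n, z = num n) ∧ ∀ F, Supports F w := by
  obtain ⟨w, hw, hmem⟩ := exists_set_of_supports (A := A) (Set.range num) Set.finite_empty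
    (by rintro _ ⟨n, rfl⟩; exact supports_num _ n)
  have hmem : ∀ z, z ∈ w ↔ ∃ n, z = num n := fun z => (hmem z).trans
    (exists_congr fun n => eq_comm)
  refine ⟨w, ⟨⟨hw, ⟨num 0, isEmptySet_num_zero, (hmem _).2 ⟨0, rfl⟩⟩, fun x hx => ?_⟩,
    fun v hv z hz => ?_⟩, hmem, fun F π _ => ?_⟩
  · obtain ⟨n, rfl⟩ := (hmem x).1 hx
    exact ⟨num (n + 1), isSucc_num_succ n, (hmem _).2 ⟨_, rfl⟩⟩
  · obtain ⟨n, rfl⟩ := (hmem z).1 hz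
    clear hz
    induction n with
    | zero =>
      obtain ⟨e, he, hev⟩ := hv.2.1
      exact isEmptySet_iff.1 he ▸ hev
    | succ n ih =>
      obtain ⟨y, hy, hyv⟩ := hv.2.2 _ ih
      exact isSucc_num_iff.1 hy ▸ hyv
  · refine ext ((isSet_smul π).2 hw) hw fun z => ?_
    rw [mem_smul_iff, hmem, hmem]
    simp only [inv_smul_eq_iff, smul_num]

theorem _root_.PermModel.IsOmega.mem_iff {w z : Vfp A} (hw : IsOmega w) :
    z ∈ w ↔ ∃ n, z = num n := by
  obtain ⟨w', hw', hmem, -⟩ := exists_isOmega (A := A)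
  rw [← hmem]
  exact ⟨hw.2 w' hw'.1 z, hw'.2 w hw.1 z⟩

/-- Finitely many elements have a common finite support, which makes an external bijection with a
numeral equivariant. -/
theorem isFinite_iff {X : Vfp A} : IsFinite X ↔ IsSet X ∧ {z | z ∈ X}.Finite := by
  constructor
  · rintro ⟨hX, w, n, f, hw, hn, hf⟩
    obtain ⟨n, rfl⟩ := hw.mem_iff.1 hn
    obtain ⟨g, -, hg, hinj⟩ := hf.1.exists_map
    refine ⟨hX, Set.Finite.of_injOn (t := num '' Set.Iio n) (fun x hx => ?_) hinj
      ((Set.finite_Iio n).image _)⟩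
    obtain ⟨k, hk, h⟩ := mem_num.1 (hg x hx)
    exact ⟨k, hk, h.symm⟩
  · rintro ⟨hX, hfin⟩
    obtain ⟨F, hF, hsupp⟩ := exists_supports_of_finite (hfin.insert X)
    obtain ⟨w, hw, hmem, -⟩ := exists_isOmega (A := A)
    have := hfin.to_subtype
    let e := Finite.equivFin {z | z ∈ X}
    classical
    obtain ⟨f, hf, hrel⟩ := exists_injection (X := X) (Y := num (Nat.card {z | z ∈ X}))
      (fun x => if h : x ∈ X then num (e ⟨x, h⟩) else x) hF (hsupp X (Or.inl rfl))
      (supports_num _ _) (fun x hx => by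
        simp only [hx, dif_pos]
        exact mem_num.2 ⟨_, (e ⟨x, hx⟩).2, rfl⟩)
      (fun x hx y hy h => by
        simp only [hx, hy, dif_pos] at h
        exact congrArg Subtype.val (e.injective (Fin.ext (num_injective h))))
      (fun π hπ x hx => by
        have hx' : π • x = x := hsupp x (Or.inr hx) π hπ
        simp [hx', hx])
    refine ⟨hX, w, _, f, hw, (hmem _).2 ⟨_, rfl⟩, hf, fun y hy => ?_⟩
    obtain ⟨k, hk, rfl⟩ := mem_num.1 hy
    refine ⟨(e.symm ⟨k, hk⟩).1, ?_⟩
    have h := hrel _ (e.symm ⟨k, hk⟩).2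
    have hx : (e.symm ⟨k, hk⟩).1 ∈ X := (e.symm ⟨k, hk⟩).2
    simpa only [hx, dif_pos, Subtype.coe_eta, Equiv.apply_symm_apply] using h

theorem isInfinite_iff {X : Vfp A} : IsInfinite X ↔ IsSet X ∧ {z | z ∈ X}.Infinite := by
  simp only [IsInfinite, isFinite_iff, not_and]
  exact ⟨fun h => ⟨h.1, h.2 h.1⟩, fun h => ⟨h.1, fun _ => h.2⟩⟩

/-- Numerals are invariant, so a support of an injection into `ω` fixes each point of its domain.
Conversely, a common support makes an external enumeration equivariant. -/
theorem isCountable_iff {X : Vfp A} : IsCountable X ↔ IsSet X ∧ {z | z ∈ X}.Countable ∧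
    ∃ F : Set (Set A), F.Finite ∧ ∀ z ∈ X, Supports F z := by
  constructor
  · rintro ⟨hX, w, f, hw, hf⟩
    obtain ⟨g, hrel, hg, hinj⟩ := hf.exists_map
    refine ⟨hX, Set.MapsTo.countable_of_injOn (t := Set.range num) (fun x hx => ?_) hinj
      (Set.countable_range _), ?_⟩
    · obtain ⟨k, h⟩ := hw.mem_iff.1 (hg x hx)
      exact ⟨k, h.symm⟩
    · obtain ⟨F, hF, hsupp⟩ := exists_supports f
      refine ⟨F, hF, fun z hz π hπ => hf.2 (π • z) z (g z) ?_ (hrel z hz)⟩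
      obtain ⟨k, h⟩ := hw.mem_iff.1 (hg z hz)
      have := (hsupp.related_smul hπ).2 (hrel z hz)
      rwa [h, smul_num, ← h] at this
  · rintro ⟨hX, hcount, F, hF, hsupp⟩
    obtain ⟨F', hF', hX'⟩ := exists_supports X
    obtain ⟨w, hw, hmem, hwsupp⟩ := exists_isOmega (A := A)
    obtain ⟨g, hg⟩ := Set.countable_iff_exists_injOn.1 hcount
    obtain ⟨f, hf, -⟩ := exists_injection (X := X) (Y := w) (fun x => num (g x))
      (hF.union hF') (hX'.mono Set.subset_union_right) (hwsupp _)
      (fun x _ => (hmem _).2 ⟨_, rfl⟩) (fun x hx y hy h => hg hx hy (num_injective h))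
      (fun π hπ x hx => by
        rw [smul_num, hsupp x hx π (fixes_anti Set.subset_union_left hπ)])
    exact ⟨hX, w, f, hw, hf⟩

/-! ### The axioms of `ZFA` in the model -/

open FirstOrder Language

/-- Finitary permutations act by automorphisms. -/
def languageEquiv (π : finitaryPerm A) : Vfp A ≃[setLanguage] Vfp A where
  toEquiv := MulAction.toPerm π
  map_fun' := fun f _ => nomatch f
  map_rel' := fun r x =>
    match r, x with
    | SetRel.mem, x => smul_mem_smul π (x := x 0) (y := x 1)
    | SetRel.atom, x => isAtom_smul π (x := x 0)

/-- The infinitely many listed parameters need not have a common finite support; this reduces to the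
finitely many that occur in the formula. -/
theorem _root_.FirstOrder.Language.Formula.realize_congr {L : Language} {M : Type*} [L.Structure M]
    {α : Type*} [DecidableEq α] (φ : L.Formula α) {v w : α → M}
    (h : ∀ a ∈ φ.freeVarFinset, v a = w a) : φ.Realize v ↔ φ.Realize w :=
  (BoundedFormula.realize_restrictFreeVar (f := id) (v := fun a => v a) v fun _ => rfl).symm.trans
    (BoundedFormula.realize_restrictFreeVar (f := id) (v := fun a => v a) w fun a => h a a.2)

/-- Every formula with parameters has a finite support. -/
theorem exists_realize_smul_iff {n : ℕ} (φ : setLanguage.Formula (Fin n ⊕ ℕ)) (q : ℕ → Vfp A) :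
    ∃ F : Set (Set A), F.Finite ∧ ∀ π ∈ fixes F, ∀ v : Fin n → Vfp A,
      φ.Realize (Sum.elim (fun i => π • v i) q) ↔ φ.Realize (Sum.elim v q) := by
  obtain ⟨F, hF, h⟩ := exists_supports_of_finite
    ((φ.freeVarFinset.finite_toSet.preimage Sum.inr_injective.injOn).image q)
  refine ⟨F, hF, fun π hπ v => ?_⟩
  rw [← StrongHomClass.realize_formula (languageEquiv π) φ (v := Sum.elim v q)]
  refine φ.realize_congr fun a ha => ?_
  rcases a with i | k
  · rfl
  · exact (h _ ⟨k, ha, rfl⟩ π hπ).symm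

theorem isModelOfZFA (A : Type u) : IsModelOfZFA (Vfp A) where
  atom_empty _ _ := notMem_of_isAtom
  set_of_atoms := by
    have : {x : Vfp A | SetStructure.IsAtom x} ⊆
        Set.range fun a : A => (exists_atom a).choose := by
      intro x hx
      obtain ⟨a, ha⟩ := Universe.isAtom_iff.1 (show SetStructure.IsAtom x.1 from hx)
      exact ⟨a, Subtype.ext ((exists_atom a).choose_spec.trans ha.symm)⟩
    have := small_subset.{u} this
    exact exists_set {x : Vfp A | SetStructure.IsAtom x} Set.finite_empty
      fun π _ x hx => (isAtom_smul π).2 hx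
  extensionality _ _ := ext
  empty_set := exists_isEmptySet
  pairing := exists_isPair
  union x := by
    obtain ⟨F, hF, hx⟩ := exists_supports x
    have : {z | ∃ y, y ∈ x ∧ z ∈ y} = ⋃ y : {y | y ∈ x}, {z | z ∈ y.1} := by
      ext z
      simp
    have : Small.{u} {z | ∃ y, y ∈ x ∧ z ∈ y} := by
      rw [this]
      infer_instance
    exact exists_set {z | ∃ y, y ∈ x ∧ z ∈ y} hF fun π hπ z ⟨y, hy, hz⟩ =>
      ⟨π • y, (hx.smul_mem_iff hπ).2 hy, (smul_mem_smul π).2 hz⟩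
  power_set x := by
    obtain ⟨F, hF, hx⟩ := exists_supports x
    have : Small.{u} {z | IsSubset z x} := by
      refine small_of_injective (β := Set {y | y ∈ x}) (f := fun z => {y | y.1 ∈ z.1}) ?_
      intro z z' h
      have key : ∀ w w' : {z | IsSubset z x},
          ({y | y.1 ∈ w.1} : Set {y | y ∈ x}) = {y | y.1 ∈ w'.1} → ∀ y, y ∈ w.1 → y ∈ w'.1 :=
        fun w w' h y hy => by
          have h1 : (⟨y, w.2.2 y hy⟩ : {y | y ∈ x}) ∈ {y : {y | y ∈ x} | y.1 ∈ w.1} := hy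
          rw [h] at h1
          exact h1
      exact Subtype.ext (ext z.2.1 z'.2.1 fun y => ⟨key z z' h y, key z' z h.symm y⟩)
    refine exists_set {z | IsSubset z x} hF fun π hπ z hz => ⟨(isSet_smul π).2 hz.1, fun y hy => ?_⟩
    rw [mem_smul_iff] at hy
    exact (hx.smul_mem_iff (inv_mem hπ)).1 (hz.2 _ hy)
  infinity := by
    obtain ⟨w, hw, -⟩ := exists_isOmega (A := A)
    exact ⟨w, hw.1⟩
  foundation x y hy := by
    obtain ⟨z, hz, hmin⟩ := mem_wf.has_min {z | z ∈ x} ⟨y, hy⟩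
    exact ⟨z, hz, fun t ht htx => hmin t htx ht⟩
  separation φ q x := by
    obtain ⟨F, hF, hφ⟩ := exists_realize_smul_iff φ q
    obtain ⟨F', hF', hx⟩ := exists_supports x
    refine exists_subset x {z | φ.Realize (Sum.elim ![z] q)} (hF.union hF')
      (hx.mono Set.subset_union_right) fun π hπ z _ hz => ?_
    refine (Iff.of_eq ?_).1 ((hφ π (fixes_anti Set.subset_union_left hπ) ![z]).2 hz)
    congr 2
    ext i
    fin_cases i
    rfl
  replacement φ q x hfun := by
    obtain ⟨F, hF, hφ⟩ := exists_realize_smul_iff φ q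
    obtain ⟨F', hF', hx⟩ := exists_supports x
    -- As `φ` is functional, a choice of preimages injects the values into `x`.
    have : Small.{u} {y | ∃ z, z ∈ x ∧ φ.Realize (Sum.elim ![z, y] q)} := by
      choose g hg hgφ using fun y : {y | ∃ z, z ∈ x ∧ φ.Realize (Sum.elim ![z, y] q)} => y.2
      refine small_of_injective (β := {z | z ∈ x}) (f := fun y => ⟨g y, hg y⟩) fun y y' h => ?_
      have h : g y = g y' := congrArg Subtype.val h
      exact Subtype.ext (hfun (g y) y.1 y'.1 (hg y) (hgφ y) (h ▸ hgφ y'))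
    refine exists_set {y | ∃ z, z ∈ x ∧ φ.Realize (Sum.elim ![z, y] q)} (hF.union hF')
      fun π hπ y ⟨z, hz, hzy⟩ => ⟨π • z,
        ((hx.mono Set.subset_union_right).smul_mem_iff hπ).2 hz, ?_⟩
    refine (Iff.of_eq ?_).1 ((hφ π (fixes_anti Set.subset_union_left hπ) ![z, y]).2 hzy)
    congr 2
    ext i
    fin_cases i <;> rfl

end Vfp

/-! ### Transpositions and finite order -/

section Swap

variable {A : Type u}

open Classical in
/-- The transposition of `a` and `b`, as a finitary permutation. -/
noncomputable def swapPerm (a b : A) : finitaryPerm A :=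
  ⟨Equiv.swap a b, (Set.toFinite {a, b}).subset fun c hc => by
    by_contra h
    simp only [Set.mem_insert_iff, Set.mem_singleton_iff, not_or] at h
    exact hc (Equiv.swap_apply_of_ne_of_ne h.1 h.2)⟩

open Classical in
theorem swapPerm_val (a b : A) : ((swapPerm a b : finitaryPerm A) : Equiv.Perm A) = Equiv.swap a b :=
  rfl

open Classical in
theorem swapPerm_self (a : A) : swapPerm a a = 1 := Subtype.ext (Equiv.swap_self a)

theorem swapPerm_comm (a b : A) : swapPerm a b = swapPerm b a :=
  Subtype.ext (by simp [swapPerm_val, Equiv.swap_comm])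

theorem swapPerm_mul_self (a b : A) : swapPerm a b * swapPerm a b = 1 :=
  Subtype.ext (by simp [swapPerm_val])

theorem mul_swapPerm (π : finitaryPerm A) (a b : A) :
    π * swapPerm a b = swapPerm ((π : Equiv.Perm A) a) ((π : Equiv.Perm A) b) * π :=
  Subtype.ext (by simp [swapPerm_val, Equiv.mul_swap_eq_swap_mul])

theorem swapPerm_mem_fixes {F : Set (Set A)} {a b : A} (h : b ∈ cell F a) :
    swapPerm a b ∈ fixes F := by
  classical
  intro p hp c
  rw [swapPerm_val]
  by_cases hca : c = a
  · rw [hca, Equiv.swap_apply_left]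
    exact h p hp
  by_cases hcb : c = b
  · rw [hcb, Equiv.swap_apply_right]
    exact (h p hp).symm
  rw [Equiv.swap_apply_of_ne_of_ne hca hcb]

/-- The group of the finitary permutations that preserve a family of sets is generated by
transpositions. -/
theorem smul_eq_of_swapPerm {X : Type*} [MulAction (finitaryPerm A) X] {x : X} {F : Set (Set A)}
    (h : ∀ a, ∀ b ∈ cell F a, swapPerm a b • x = x) {π : finitaryPerm A} (hπ : π ∈ fixes F) :
    π • x = x := by
  classical
  have hind : ∀ (n : ℕ) (π : finitaryPerm A), π ∈ fixes F →
      {a | (π : Equiv.Perm A) a ≠ a}.ncard = n → π • x = x := by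
    intro n
    induction n using Nat.strong_induction_on with
    | _ n ih =>
      intro π hπ hn
      by_cases hall : ∀ a, (π : Equiv.Perm A) a = a
      · have : π = 1 := Subtype.ext (Equiv.ext hall)
        rw [this, one_smul]
      push Not at hall
      obtain ⟨a, ha⟩ := hall
      set b := (π : Equiv.Perm A) a with hb
      have hmem : b ∈ cell F a := mem_fixes_iff_cell.1 hπ a
      -- Composing with the transposition of `a` and `π a` fixes `a` and moves no new point; it
      -- stays in the group because `π` preserves cells.
      have hlt : {c | ((swapPerm a b * π : finitaryPerm A) : Equiv.Perm A) c ≠ c}.ncard < n := by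
        rw [← hn]
        refine Set.ncard_lt_ncard (Set.ssubset_iff_of_subset ?_ |>.2 ⟨a, ha, ?_⟩) π.2
        · intro c hc hcπ
          refine hc ?_
          rw [Subgroup.coe_mul, Equiv.Perm.mul_apply, hcπ, swapPerm_val]
          refine Equiv.swap_apply_of_ne_of_ne ?_ ?_
          · rintro rfl
            exact ha hcπ
          · rintro rfl
            exact ha ((π : Equiv.Perm A).injective hcπ)
        · simp [swapPerm_val, ← hb]
      have h1 := ih _ hlt _ (mul_mem (swapPerm_mem_fixes hmem) hπ) rfl
      rw [mul_smul, ← eq_inv_smul_iff] at h1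
      rw [h1, inv_smul_eq_iff]
      exact (h a b hmem).symm
  exact hind _ π hπ rfl

/-- Finitary permutations have finite order. -/
theorem isOfFinOrder_finitaryPerm (π : finitaryPerm A) : IsOfFinOrder π := by
  classical
  have hfin : Finite {a // (π : Equiv.Perm A) a ≠ a} := Set.Finite.to_subtype π.2
  have h1 : ∀ a, (π : Equiv.Perm A) ((π : Equiv.Perm A) a) ≠ (π : Equiv.Perm A) a ↔
      (π : Equiv.Perm A) a ≠ a := fun a => (π : Equiv.Perm A).injective.ne_iff
  -- `π` extends a permutation of the finite set of points that it moves.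
  have h2 := Equiv.Perm.ofSubtype_subtypePerm h1 fun a ha => ha
  have h3 : IsOfFinOrder (π : Equiv.Perm A) := by
    rw [← h2]
    exact MonoidHom.isOfFinOrder _ (isOfFinOrder_of_finite _)
  exact (Submonoid.isOfFinOrder_coe).1 h3

end Swap

/-! ### The dichotomy for sets of the model -/

namespace Vfp

variable {A : Type u}

/-- If some element of `X` is not fixed by a support of `X`, then `X` contains an injective image
of an infinite set of atoms, by a map that has a finite support. -/
theorem exists_injOn_of_not_supports {X : Vfp A} {E : Set (Set A)} (hE : E.Finite)
    (hX : Supports E X) (hcell : ∀ a b, b ∈ cell E a → b ≠ a → (cell E a).Infinite)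
    {x : Vfp A} (hx : x ∈ X) (hxE : ¬ Supports E x) :
    ∃ (p : Set A) (y : A → Vfp A) (F : Set (Set A)), p.Infinite ∧ F.Finite ∧
      (∀ a ∈ p, y a ∈ X) ∧ Set.InjOn y p ∧
      ∀ π ∈ fixes F, ∀ a ∈ p, (π : Equiv.Perm A) a ∈ p ∧ π • y a = y ((π : Equiv.Perm A) a) := by
  classical
  obtain ⟨F, hF, hFx⟩ := exists_supports x
  obtain ⟨a₁, b₁, hab₁, hne₁⟩ : ∃ a, ∃ b ∈ cell E a, swapPerm a b • x ≠ x := by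
    by_contra! h
    exact hxE fun π hπ => smul_eq_of_swapPerm h hπ
  -- Transitivity of the relation `(a b) x = x`, by conjugation: `(b c) (a b) = (a c) (b c)`.
  have htrans : ∀ a b c : A, swapPerm a b • x = x → swapPerm b c • x = x →
      swapPerm a c • x = x := by
    intro a b c h1 h2
    by_cases hac : a = c
    · rw [hac, swapPerm_self, one_smul]
    by_cases hab : a = b
    · rwa [hab]
    have h3 := mul_swapPerm (swapPerm b c) a b
    rw [swapPerm_val, Equiv.swap_apply_left, Equiv.swap_apply_of_ne_of_ne hab hac] at h3
    have h4 := congrArg (· • x) h3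
    simp only [mul_smul, h1, h2] at h4
    exact h4.symm
  have hsymm : ∀ a b : A, swapPerm a b • x = x → swapPerm b a • x = x := fun a b h => by
    rwa [swapPerm_comm]
  -- an infinite cell of `F` inside the cell of `a₁`
  have hinf : (cell E a₁).Infinite := hcell a₁ b₁ hab₁ (by
    rintro rfl
    exact hne₁ (by rw [swapPerm_self, one_smul]))
  obtain ⟨c, hc⟩ := exists_infinite_inter_cell hinf hF
  set p := cell E a₁ ∩ cell F c with hp
  have hpp : ∀ a ∈ p, ∀ a' ∈ p, swapPerm a a' • x = x := fun a ha a' ha' =>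
    hFx _ (swapPerm_mem_fixes (by rw [cell_eq ha.2]; exact ha'.2))
  obtain ⟨a₀, ha₀⟩ := hc.nonempty
  -- If the whole cell of `a₁` were equivalent to `a₀`, then `a₁` and `b₁` would be equivalent.
  obtain ⟨b, hbE, hb⟩ : ∃ b ∈ cell E a₁, swapPerm a₀ b • x ≠ x := by
    by_contra! h
    exact hne₁ (htrans _ a₀ _ (hsymm _ _ (h a₁ (mem_cell_self E a₁))) (h b₁ hab₁))
  have hpb : ∀ a ∈ p, swapPerm a b • x ≠ x := fun a ha h =>
    hb (htrans _ _ _ (hpp a₀ ha₀ a ha) h)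
  have hbp : b ∉ p := fun h => hpb b h (by rw [swapPerm_self, one_smul])
  -- `F` keeps `x` fixed, `{b}` keeps `b` fixed and `p` preserves the domain, so `π` carries `(a b)
  -- x` to `(π a b) x`.
  refine ⟨p, fun a => swapPerm a b • x, E ∪ F ∪ {{b}, p}, hc, (hE.union hF).union (Set.toFinite _),
    fun a ha => ?_, fun a ha a' ha' h => ?_, fun π hπ a ha => ?_⟩
  · refine (hX.smul_mem_iff (swapPerm_mem_fixes ?_)).2 hx
    rw [cell_eq ha.1]
    exact hbE
  · by_contra hne
    refine hpb a ha ?_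
    have h : swapPerm a b • x = swapPerm a' b • x := h
    have hab : a ≠ b := fun e => hbp (e ▸ ha)
    have hab' : a' ≠ b := fun e => hbp (e ▸ ha')
    -- `(a' b) (a b) = (a b) (a a')`
    have h1 := mul_swapPerm (swapPerm a b) a a'
    rw [swapPerm_val, Equiv.swap_apply_left,
      Equiv.swap_apply_of_ne_of_ne (Ne.symm hne) hab'] at h1
    have h2 := congrArg (· • x) h1
    simp only [mul_smul, hpp a ha a' ha'] at h2
    -- By `h` the right-hand side is `(a' b) (a' b) x = x`, so that `(a b) x = x`.
    rw [h, swapPerm_comm b a', ← mul_smul, swapPerm_mul_self, one_smul] at h2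
    rw [h, h2]
  · have hπp : ∀ a, (π : Equiv.Perm A) a ∈ p ↔ a ∈ p := hπ p (by simp)
    have hπb : (π : Equiv.Perm A) b = b := (hπ {b} (by simp) b).2 rfl
    have hπF : π ∈ fixes F := fixes_anti (fun q hq => Or.inl (Or.inr hq)) hπ
    refine ⟨(hπp a).2 ha, ?_⟩
    rw [← mul_smul, mul_swapPerm, mul_smul, hFx π hπF, hπb]

/-- Either the elements of `X` have a common finite support, or `X` contains an injective image of
an infinite set of atoms, by a map that has a finite support. -/
theorem exists_supports_or_injOn (X : Vfp A) :
    (∃ F : Set (Set A), F.Finite ∧ Supports F X ∧ ∀ x ∈ X, Supports F x) ∨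
    ∃ (p : Set A) (y : A → Vfp A) (F : Set (Set A)), p.Infinite ∧ F.Finite ∧
      (∀ a ∈ p, y a ∈ X) ∧ Set.InjOn y p ∧
      ∀ π ∈ fixes F, ∀ a ∈ p,
        (π : Equiv.Perm A) a ∈ p ∧ π • y a = y ((π : Equiv.Perm A) a) := by
  obtain ⟨E₀, hE₀, hX₀⟩ := exists_supports X
  obtain ⟨E, hEE, hE, hcell⟩ := exists_finite_cells_subsingleton hE₀
  by_cases h : ∀ x ∈ X, Supports E x
  · exact Or.inl ⟨E, hE, hX₀.mono hEE, h⟩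
  · push Not at h
    obtain ⟨x, hx, hxE⟩ := h
    exact Or.inr (exists_injOn_of_not_supports hE (hX₀.mono hEE) hcell hx hxE)

/-! ### The antichain principle and disjoint cofinal subsets -/

/-- An element of a poset that is comparable to its image under a symmetry of finite order is fixed
by the symmetry. -/
theorem smul_eq_of_related {P R : Vfp A} (h : IsPoset P R) {F : Set (Set A)}
    (hR : Supports F R) {π : finitaryPerm A} (hπ : π ∈ fixes F) {x : Vfp A}
    (hx : Related R x (π • x)) : π • x = x := by
  obtain ⟨-, hrel, hrefl, hanti, htrans⟩ := h
  set z := π • x with hz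
  have hzP : z ∈ P := (hrel.mem_of_related hx).2
  have hzz : Related R z (π • z) := (hR.related_smul hπ).2 hx
  -- The chain `x ≤ π x ≤ π² x ≤ …` closes up after `n` steps, where `π ^ n = 1`: the exponent `n -
  -- 1` gives `π x ≤ x`.
  have hpow : ∀ k : ℕ, Related R z (π ^ k • z) := by
    intro k
    induction k with
    | zero => simpa using hrefl z hzP
    | succ k ih =>
      rw [pow_succ', mul_smul]
      exact htrans _ _ _ hzz ((hR.related_smul hπ).2 ih)
  obtain ⟨n, hn, hn1⟩ := isOfFinOrder_iff_pow_eq_one.1 (isOfFinOrder_finitaryPerm π)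
  have h1 := hpow (n - 1)
  rw [hz, ← mul_smul, ← pow_succ, Nat.sub_add_cancel hn, hn1, one_smul] at h1
  exact hanti _ _ h1 hx

/-- The orbits of a poset under the group of a finite support form a poset. -/
theorem exists_orbit_poset {P R : Vfp A} (h : IsPoset P R) :
    ∃ (β : Type (u + 1)) (_ : PartialOrder β) (F : Set (Set A)) (f : {x // x ∈ P} → β),
      F.Finite ∧ Supports F P ∧ Supports F R ∧ Function.Surjective f ∧
      (∀ x y, f x ≤ f y ↔ ∃ π ∈ fixes F, Related R x.1 (π • y.1)) ∧
      (∀ x y, f x = f y ↔ ∃ π ∈ fixes F, x.1 = π • y.1) ∧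
      ∀ x y, Related R x.1 y.1 → f x = f y → x = y := by
  obtain ⟨F, hF, hsupp⟩ := exists_supports_of_finite (Set.toFinite {P, R})
  have hP : Supports F P := hsupp P (by simp)
  have hR : Supports F R := hsupp R (by simp)
  have hpos := h
  obtain ⟨-, hrel, hrefl, hanti, htrans⟩ := h
  let : Preorder {x // x ∈ P} :=
    { le := fun x y => ∃ π ∈ fixes F, Related R x.1 (π • y.1)
      le_refl := fun x => ⟨1, one_mem _, by simpa using hrefl x.1 x.2⟩
      le_trans := by
        rintro x y z ⟨π, hπ, hxy⟩ ⟨ρ, hρ, hyz⟩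
        refine ⟨π * ρ, mul_mem hπ hρ, htrans _ _ _ hxy ?_⟩
        rw [mul_smul]
        exact (hR.related_smul hπ).2 hyz }
  have hle : ∀ x y : {x // x ∈ P}, x ≤ y ↔ ∃ π ∈ fixes F, Related R x.1 (π • y.1) :=
    fun x y => Iff.rfl
  -- From `x ≤ π y` and `y ≤ ρ x` follows `x ≤ π ρ x`, so `x = π ρ x` by finite order and then `x =
  -- π y`.
  have heq : ∀ x y : {x // x ∈ P}, toAntisymmetrization (· ≤ ·) x = toAntisymmetrization (· ≤ ·) y ↔
      ∃ π ∈ fixes F, x.1 = π • y.1 := by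
    intro x y
    refine (Quotient.eq (r := AntisymmRel.setoid {x // x ∈ P} (· ≤ ·))).trans ?_
    constructor
    · rintro ⟨⟨π, hπ, hxy⟩, ⟨ρ, hρ, hyx⟩⟩
      refine ⟨π, hπ, ?_⟩
      have h1 : Related R (π • y.1) ((π * ρ) • x.1) := by
        rw [mul_smul]
        exact (hR.related_smul hπ).2 hyx
      have h2 := smul_eq_of_related hpos hR (mul_mem hπ hρ) (htrans _ _ _ hxy h1)
      rw [h2] at h1
      exact hanti _ _ hxy h1
    · rintro ⟨π, hπ, hxy⟩
      refine ⟨⟨π, hπ, ?_⟩, ⟨π⁻¹, inv_mem hπ, ?_⟩⟩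
      · rw [← hxy]
        exact hrefl _ x.2
      · rw [hxy, inv_smul_smul]
        exact hrefl _ y.2
  refine ⟨Antisymmetrization {x // x ∈ P} (· ≤ ·), inferInstance, F,
    toAntisymmetrization (· ≤ ·), hF, hP, hR, Quotient.mk_surjective, fun x y => Iff.rfl, heq,
    fun x y hxy he => ?_⟩
  obtain ⟨π, hπ, hyx⟩ := (heq y x).1 he.symm
  rw [hyx] at hxy
  exact Subtype.ext (hyx.trans (smul_eq_of_related hpos hR hπ hxy)).symm

/-- A union of orbits is a set of the model. -/
theorem exists_preimage_subset {P : Vfp A} {β : Type*} {F : Set (Set A)}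
    {f : {x // x ∈ P} → β} (hF : F.Finite) (hP : Supports F P)
    (hf : ∀ x y, f x = f y ↔ ∃ π ∈ fixes F, x.1 = π • y.1) (C : Set β) :
    ∃ X : Vfp A, IsSubset X P ∧ ∀ x, x.1 ∈ X ↔ f x ∈ C := by
  obtain ⟨X, hX, hmem⟩ := exists_subset P {x | ∃ h : x ∈ P, f ⟨x, h⟩ ∈ C} hF hP
    (fun π hπ x _ ⟨h, hx⟩ => ⟨(hP.smul_mem_iff hπ).2 h, by
      rwa [(hf ⟨π • x, (hP.smul_mem_iff hπ).2 h⟩ ⟨x, h⟩).2 ⟨π, hπ, rfl⟩]⟩)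
  refine ⟨X, ⟨hX, fun z hz => ((hmem z).1 hz).1⟩, fun x => (hmem x.1).trans ?_⟩
  exact ⟨fun h => h.2.2, fun h => ⟨x.2, x.2, h⟩⟩

/-- The union `C` of a maximal antichain of orbits works. Comparable elements of one orbit coincide,
so `C` is an antichain. If the orbit of `d` is comparable to an orbit in `C`, then `d` itself is
comparable to some element of that orbit, hence of `C`; this gives maximality. -/
theorem antichainPrinciple (A : Type u) : AntichainPrinciple (Vfp A) := by
  intro P R h
  obtain ⟨β, _, F, f, hF, hP, hR, hsurj, hle, heq, hinj⟩ := exists_orbit_poset h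
  obtain ⟨I, -, hI⟩ := zorn_subset_nonempty {I : Set β | I.Pairwise fun x y => ¬ x ≤ y}
    (fun c hc hchain _ => ⟨⋃₀ c, (Set.pairwise_sUnion hchain.directedOn).2 fun s hs => hc hs,
      fun s hs => Set.subset_sUnion_of_mem hs⟩) ∅ (Set.pairwise_empty _)
  obtain ⟨C, hCP, hC⟩ := exists_preimage_subset hF hP heq I
  refine ⟨C, ⟨hCP, fun x y hx hy hne hxy => hne ?_⟩, fun D hD hCD => ?_⟩
  · have hx' := (hC ⟨x, hCP.2 x hx⟩).1 hx
    have hy' := (hC ⟨y, hCP.2 y hy⟩).1 hy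
    have hle' : f ⟨x, hCP.2 x hx⟩ ≤ f ⟨y, hCP.2 y hy⟩ :=
      (hle _ _).2 ⟨1, one_mem _, by simpa using hxy⟩
    exact congrArg Subtype.val (hinj ⟨x, hCP.2 x hx⟩ ⟨y, hCP.2 y hy⟩ hxy
      (by_contra fun hne => hI.prop hx' hy' hne hle'))
  · refine ext hD.1.1 hCP.1 fun d => ⟨fun hd => ?_, hCD.2 d⟩
    have hdP := hD.1.2 d hd
    by_contra hdC
    have hdI : f ⟨d, hdP⟩ ∉ I := fun h => hdC ((hC ⟨d, hdP⟩).2 h)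
    have hne : ∀ (c : {x // x ∈ P}), f c ∈ I → c.1 ≠ d := by
      rintro c hc rfl
      exact hdI hc
    refine hdI (hI.le_of_ge (y := insert (f ⟨d, hdP⟩) I)
      (Set.Pairwise.insert hI.prop fun b hb _ => ?_) (Set.subset_insert _ _) (Set.mem_insert _ _))
    obtain ⟨c, rfl⟩ := hsurj b
    have hsmul : ∀ π ∈ fixes F, π • c.1 ∈ D ∧ π • c.1 ≠ d := by
      intro π hπ
      have hmem : π • c.1 ∈ P := (hP.smul_mem_iff hπ).2 c.2
      have hI' : f ⟨π • c.1, hmem⟩ ∈ I := by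
        rwa [(heq ⟨π • c.1, hmem⟩ c).2 ⟨π, hπ, rfl⟩]
      exact ⟨hCD.2 _ ((hC ⟨π • c.1, hmem⟩).2 hI'), hne _ hI'⟩
    constructor
    · intro h1
      obtain ⟨π, hπ, h2⟩ := (hle _ _).1 h1
      exact hD.2 _ _ hd (hsmul π hπ).1 (hsmul π hπ).2.symm h2
    · intro h1
      obtain ⟨π, hπ, h2⟩ := (hle _ _).1 h1
      have hπ' := inv_mem hπ
      refine hD.2 _ _ (hsmul π⁻¹ hπ').1 hd (hsmul π⁻¹ hπ').2 ?_
      rwa [← hR.related_smul hπ, smul_inv_smul]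

/-- An element strictly above `x` lies in another orbit, so the orbit poset has no maximal element;
disjoint cofinal sets of orbits have disjoint cofinal unions. -/
theorem cs (A : Type u) : CS (Vfp A) := by
  intro P R h hmax
  obtain ⟨β, _, F, f, hF, hP, hR, hsurj, hle, heq, hinj⟩ := exists_orbit_poset h
  have : NoMaxOrder β := ⟨fun b => by
    obtain ⟨x, rfl⟩ := hsurj b
    obtain ⟨y, hxy, hne⟩ : ∃ y, Related R x.1 y ∧ y ≠ x.1 := by
      by_contra! hcon
      exact hmax x.1 ⟨x.2, hcon⟩
    have hy := (h.2.1.mem_of_related hxy).2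
    refine ⟨f ⟨y, hy⟩, lt_of_le_of_ne ((hle _ _).2 ⟨1, one_mem _, by simpa using hxy⟩) fun e => ?_⟩
    exact hne (congrArg Subtype.val (hinj x ⟨y, hy⟩ hxy e)).symm⟩
  obtain ⟨C, D, hCD, hC, hD⟩ := exists_disjoint_cofinal (α := β)
  have key : ∀ C : Set β, (∀ x, ∃ c ∈ C, x ≤ c) →
      ∃ X : Vfp A, IsCofinal P R X ∧ ∀ x : {x // x ∈ P}, x.1 ∈ X ↔ f x ∈ C := by
    intro C hC
    obtain ⟨X, hXP, hX⟩ := exists_preimage_subset hF hP heq C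
    refine ⟨X, ⟨hXP, fun x hx => ?_⟩, hX⟩
    obtain ⟨b, hb, hxb⟩ := hC (f ⟨x, hx⟩)
    obtain ⟨y, rfl⟩ := hsurj b
    obtain ⟨π, hπ, hxy⟩ := (hle _ _).1 hxb
    have hmem : π • y.1 ∈ P := (hP.smul_mem_iff hπ).2 y.2
    refine ⟨π • y.1, (hX ⟨_, hmem⟩).2 ?_, hxy⟩
    rwa [(heq ⟨π • y.1, hmem⟩ y).2 ⟨π, hπ, rfl⟩]
  obtain ⟨X, hXc, hX⟩ := key C hC
  obtain ⟨Y, hYc, hY⟩ := key D hD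
  refine ⟨X, Y, hXc, hYc, fun z hz hz' => ?_⟩
  have hzP := hXc.1.2 z hz
  exact Set.disjoint_left.1 hCD ((hX ⟨z, hzP⟩).1 hz) ((hY ⟨z, hzP⟩).1 hz')

end Vfp

/-! ### Homogeneity of cells, amorphous sets and partition theorems -/

theorem exists_subset_infinite_diff {α : Type*} {S : Set α} (hS : S.Infinite) :
    ∃ H ⊆ S, H.Infinite ∧ (S \ H).Infinite := by
  let e := hS.natEmbedding
  have hinj : Function.Injective fun n => (e n : α) := fun m n h => e.injective (Subtype.ext h)
  refine ⟨Set.range fun n => (e (2 * n) : α), ?_, Set.infinite_range_of_injective fun m n h => ?_,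
    (Set.infinite_range_of_injective (f := fun n => (e (2 * n + 1) : α)) fun m n h => ?_).mono ?_⟩
  · rintro _ ⟨n, rfl⟩
    exact (e _).2
  · have := hinj h
    omega
  · have := hinj h
    omega
  · rintro _ ⟨n, rfl⟩
    refine ⟨(e _).2, ?_⟩
    rintro ⟨m, h⟩
    have := hinj h
    omega

open Classical in
/-- The permutations that preserve a family of sets act transitively on the finite subsets of a
given size of a cell. -/
theorem exists_image_eq {A : Type u} {F : Set (Set A)} {a : A} (n : ℕ)
    (s t : Finset A) (hs : ↑s ⊆ cell F a) (ht : ↑t ⊆ cell F a) (hcard : s.card = t.card)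
    (hn : (s \ t).card = n) : ∃ π ∈ fixes F, s.image (π : Equiv.Perm A) = t := by
  induction n generalizing s with
  | zero =>
    have hst : s ⊆ t := by simpa using hn
    exact ⟨1, one_mem _, by simp [Finset.eq_of_subset_of_card_le hst hcard.ge]⟩
  | succ n ih =>
    obtain ⟨x, hx⟩ : (s \ t).Nonempty := Finset.card_pos.1 (by omega)
    obtain ⟨y, hy⟩ : (t \ s).Nonempty := Finset.card_pos.1 (by
      rw [← Finset.card_sdiff_comm hcard]
      omega)
    rw [Finset.mem_sdiff] at hx hy
    have hxc := hs hx.1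
    have hyc := ht hy.1
    -- Exchanging `x ∈ s \ t` for `y ∈ t \ s` shrinks the difference by one without leaving the
    -- cell.
    have hswap : swapPerm x y ∈ fixes F := swapPerm_mem_fixes (by rwa [cell_eq hxc])
    have himg : s.image (swapPerm x y : Equiv.Perm A) = insert y (s.erase x) := by
      ext z
      simp only [Finset.mem_image, Finset.mem_insert, Finset.mem_erase, swapPerm_val]
      constructor
      · rintro ⟨w, hw, rfl⟩
        by_cases hwx : w = x
        · simp [hwx]
        · have hwy : w ≠ y := fun e => hy.2 (e ▸ hw)
          rw [Equiv.swap_apply_of_ne_of_ne hwx hwy]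
          exact Or.inr ⟨hwx, hw⟩
      · rintro (rfl | ⟨hzx, hz⟩)
        · exact ⟨x, hx.1, Equiv.swap_apply_left _ _⟩
        · exact ⟨z, hz, Equiv.swap_apply_of_ne_of_ne hzx fun e => hy.2 (e ▸ hz)⟩
    obtain ⟨π, hπ, h⟩ := ih (s.image (swapPerm x y : Equiv.Perm A)) (by
        rw [himg, Finset.coe_insert, Set.insert_subset_iff]
        exact ⟨hyc, fun z hz => hs (Finset.mem_of_mem_erase hz)⟩)
      (by rw [Finset.card_image_of_injective _ (Equiv.injective _), hcard])
      (by
        have : insert y (s.erase x) \ t = (s \ t).erase x := by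
          ext z
          simp only [Finset.mem_sdiff, Finset.mem_insert, Finset.mem_erase]
          by_cases hzy : z = y
          · subst hzy
            simp [hy.1]
          · simp [hzy, and_assoc]
        rw [himg, this, Finset.card_erase_of_mem (Finset.mem_sdiff.2 hx), hn]
        rfl)
    refine ⟨π * swapPerm x y, mul_mem hπ hswap, ?_⟩
    rw [← h, Finset.image_image]
    rfl

namespace Vfp

variable {A : Type u}

/-- Either the elements of `X` have a common finite support, or `X` contains an injective image of
an infinite cell of a finite family of sets, by a map supported by the family. -/
theorem exists_supports_or_cell (X : Vfp A) {F₀ : Set (Set A)} (hF₀ : F₀.Finite) :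
    (∃ F : Set (Set A), F.Finite ∧ ∀ x ∈ X, Supports F x) ∨
    ∃ (F : Set (Set A)) (c : A) (y : A → Vfp A), F₀ ⊆ F ∧ F.Finite ∧ (cell F c).Infinite ∧
      (∀ a ∈ cell F c, y a ∈ X) ∧ Set.InjOn y (cell F c) ∧
      ∀ π ∈ fixes F, ∀ a ∈ cell F c, π • y a = y ((π : Equiv.Perm A) a) := by
  rcases exists_supports_or_injOn X with ⟨F, hF, -, h⟩ | ⟨p, y, F, hp, hF, hyX, hinj, hπ⟩
  · exact Or.inl ⟨F, hF, h⟩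
  · have hfin : (insert p (F₀ ∪ F)).Finite := (hF₀.union hF).insert p
    obtain ⟨c, hc⟩ := exists_infinite_inter_cell hp hfin
    have hsub : cell (insert p (F₀ ∪ F)) c ⊆ p := by
      obtain ⟨a, ha⟩ := hc.nonempty
      intro b hb
      exact (hb p (Or.inl rfl)).2 ((ha.2 p (Or.inl rfl)).1 ha.1)
    exact Or.inr ⟨insert p (F₀ ∪ F), c, y, fun q hq => Or.inr (Or.inl hq), hfin,
      hc.mono Set.inter_subset_right, fun a ha => hyX a (hsub ha), hinj.mono hsub,
      fun π hπF a ha => (hπ π (fixes_anti (fun q hq => Or.inr (Or.inr hq)) hπF) a (hsub ha)).2⟩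

theorem exists_finSet (s : Finset (Vfp A)) : ∃ X : Vfp A, IsSet X ∧ ∀ z, z ∈ X ↔ z ∈ s :=
  exists_set_of_finite s.finite_toSet

/-- The set with the elements of the finset `s`. -/
noncomputable def finSet (s : Finset (Vfp A)) : Vfp A := (exists_finSet s).choose

theorem isSet_finSet (s : Finset (Vfp A)) : IsSet (finSet s) := (exists_finSet s).choose_spec.1

@[simp]
theorem mem_finSet {s : Finset (Vfp A)} {z : Vfp A} : z ∈ finSet s ↔ z ∈ s :=
  (exists_finSet s).choose_spec.2 z

theorem finSet_injective : Function.Injective (finSet : Finset (Vfp A) → Vfp A) := fun s t h =>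
  Finset.ext fun z => by rw [← mem_finSet, h, mem_finSet]

open Classical in
theorem smul_finSet (π : finitaryPerm A) (s : Finset (Vfp A)) :
    π • finSet s = finSet (s.image (π • ·)) := by
  refine ext ((isSet_smul π).2 (isSet_finSet s)) (isSet_finSet _) fun z => ?_
  rw [mem_smul_iff, mem_finSet, mem_finSet, Finset.mem_image]
  exact ⟨fun h => ⟨_, h, smul_inv_smul π z⟩, by rintro ⟨w, hw, rfl⟩; rwa [inv_smul_smul]⟩

/-- Lets colorings of the model be studied as functions on external finsets. -/
theorem isSubsetOfSize_iff {m : ℕ} {X s : Vfp A} : IsSubsetOfSize m X s ↔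
    ∃ t : Finset (Vfp A), ↑t ⊆ {z | z ∈ X} ∧ t.card = m ∧ s = finSet t := by
  constructor
  · rintro ⟨⟨hs, hsX⟩, hm⟩
    have hfin : {z | z ∈ s}.Finite := Set.finite_of_encard_eq_coe hm
    refine ⟨hfin.toFinset, by simpa using hsX, ?_, ext hs (isSet_finSet _) fun z => by simp⟩
    rw [hfin.encard_eq_coe_toFinset_card] at hm
    exact_mod_cast hm
  · rintro ⟨t, ht, hm, rfl⟩
    refine ⟨⟨isSet_finSet t, fun z hz => ht (mem_finSet.1 hz)⟩, ?_⟩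
    have : {z | z ∈ finSet t} = ↑t := by
      ext z
      simp
    rw [this, Set.encard_coe_eq_coe_finsetCard, hm]

/-- A coloring of the model induces a coloring of finsets. -/
theorem exists_color {m : ℕ} {X C χ : Vfp A} (h : IsColoring m X C χ) :
    ∃ c : Finset (Vfp A) → Vfp A, ∀ s : Finset (Vfp A), ↑s ⊆ {z | z ∈ X} → s.card = m →
      c s ∈ C ∧ ∀ d, Related χ (finSet s) d ↔ d = c s := by
  obtain ⟨-, -, D, hD, hχ⟩ := h
  have : ∀ s : Finset (Vfp A), ↑s ⊆ {z | z ∈ X} → s.card = m →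
      ∃ d, d ∈ C ∧ ∀ d', Related χ (finSet s) d' ↔ d' = d := by
    intro s hs hm
    obtain ⟨d, hd, huniq⟩ := hχ.2 (finSet s) ((hD.2 _).2 (isSubsetOfSize_iff.2 ⟨s, hs, hm, rfl⟩))
    exact ⟨d, (hχ.1.mem_of_related hd).2, fun d' => ⟨huniq d', by rintro rfl; exact hd⟩⟩
  choose! c hc using this
  exact ⟨c, hc⟩

/-- An external subset of a set whose elements have a common finite support is a set of the
model. -/
theorem exists_isSubset_of_supports {X : Vfp A} {F : Set (Set A)} (hF : F.Finite)
    (hX : ∀ x ∈ X, Supports F x) {H : Set (Vfp A)} (hH : H ⊆ {z | z ∈ X}) :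
    ∃ Y : Vfp A, IsSubset Y X ∧ {z | z ∈ Y} = H := by
  have : Small.{u} H := small_subset hH
  obtain ⟨Y, hY, hmem⟩ := exists_set_of_supports H hF fun x hx => hX x (hH hx)
  exact ⟨Y, ⟨hY, fun z hz => hH ((hmem z).1 hz)⟩, Set.ext hmem⟩

/-- The image of a cell is a set of the model. -/
theorem exists_isSubset_image {X : Vfp A} {F : Set (Set A)} (hF : F.Finite) {q : Set A}
    {y : A → Vfp A} (hyX : ∀ a ∈ q, y a ∈ X)
    (hy : ∀ π ∈ fixes F, ∀ a ∈ q, (π : Equiv.Perm A) a ∈ q ∧ π • y a = y ((π : Equiv.Perm A) a)) :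
    ∃ Y : Vfp A, IsSubset Y X ∧ {z | z ∈ Y} = y '' q := by
  have hsub : y '' q ⊆ {z | z ∈ X} := by
    rintro _ ⟨a, ha, rfl⟩
    exact hyX a ha
  have : Small.{u} (y '' q) := small_subset hsub
  obtain ⟨Y, hY, hmem⟩ := exists_set (y '' q) hF (by
    rintro π hπ _ ⟨a, ha, rfl⟩
    exact ⟨_, (hy π hπ a ha).1, ((hy π hπ a ha).2).symm⟩)
  exact ⟨Y, ⟨hY, fun z hz => hsub ((hmem z).1 hz)⟩, Set.ext hmem⟩

theorem apply_mem_cell {F : Set (Set A)} {π : finitaryPerm A} (hπ : π ∈ fixes F) {a c : A}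
    (ha : a ∈ cell F c) : (π : Equiv.Perm A) a ∈ cell F c := by
  rw [← cell_eq ha]
  exact mem_fixes_iff_cell.1 hπ a

open Classical in
/-- The coloring induced by a coloring of the model on the finite subsets of a cell is
equivariant. -/
theorem color_image {m : ℕ} {X χ : Vfp A} {F : Set (Set A)} {q : A} {y : A → Vfp A}
    {c : Finset (Vfp A) → Vfp A} (hχ : Supports F χ)
    (hyX : ∀ a ∈ cell F q, y a ∈ X) (hinj : Set.InjOn y (cell F q))
    (hy : ∀ π ∈ fixes F, ∀ a ∈ cell F q, π • y a = y ((π : Equiv.Perm A) a))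
    (hc : ∀ s : Finset (Vfp A), ↑s ⊆ {z | z ∈ X} → s.card = m →
      ∀ d, Related χ (finSet s) d ↔ d = c s)
    {π : finitaryPerm A} (hπ : π ∈ fixes F) {s : Finset A} (hs : ↑s ⊆ cell F q)
    (hm : s.card = m) :
    c ((s.image (π : Equiv.Perm A)).image y) = π • c (s.image y) := by
  have hmem : ∀ t : Finset A, ↑t ⊆ cell F q → ↑(t.image y) ⊆ {z | z ∈ X} := by
    intro t ht z hz
    obtain ⟨a, ha, rfl⟩ := Finset.mem_image.1 (Finset.mem_coe.1 hz)
    exact hyX a (ht ha)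
  have hcard : ∀ t : Finset A, ↑t ⊆ cell F q → (t.image y).card = t.card := fun t ht =>
    Finset.card_image_of_injOn (hinj.mono ht)
  have hs' : ↑(s.image (π : Equiv.Perm A)) ⊆ cell F q := by
    intro z hz
    obtain ⟨a, ha, rfl⟩ := Finset.mem_image.1 (Finset.mem_coe.1 hz)
    exact apply_mem_cell hπ (hs ha)
  have himg : (s.image (π : Equiv.Perm A)).image y = (s.image y).image (π • ·) := by
    rw [Finset.image_image, Finset.image_image]
    exact Finset.image_congr fun a ha => (hy π hπ a (hs ha)).symm
  have h1 := (hc (s.image y) (hmem s hs) (by rw [hcard s hs, hm]) _).2 rfl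
  rw [← hχ.related_smul hπ, smul_finSet, ← himg] at h1
  refine ((hc _ (hmem _ hs') ?_ _).1 h1).symm
  rw [hcard _ hs', Finset.card_image_of_injective _ (Equiv.injective _), hm]

theorem infinite_of_isInfinite {X : Vfp A} (hX : IsInfinite X) : {z | z ∈ X}.Infinite :=
  (isInfinite_iff.1 hX).2

/-- Under a common support any external splitting lies in the model. Otherwise half of the cell is
adjoined to the family, which then supports the image of that half. -/
theorem noAmorphousSets (A : Type u) : NoAmorphousSets (Vfp A) := by
  rintro S ⟨hS, hno⟩
  obtain ⟨X, hXS, hX, hdiff⟩ : ∃ X : Vfp A, IsSubset X S ∧ {z | z ∈ X}.Infinite ∧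
      ({z | z ∈ S} \ {z | z ∈ X}).Infinite := by
    rcases exists_supports_or_cell S Set.finite_empty with
      ⟨F, hF, hsupp⟩ | ⟨F, c, y, -, hF, hinf, hyS, hinj, hy⟩
    · obtain ⟨H, hHS, hH, hdiff⟩ := exists_subset_infinite_diff (infinite_of_isInfinite hS)
      obtain ⟨X, hXS, hX⟩ := exists_isSubset_of_supports hF hsupp hHS
      exact ⟨X, hXS, hX ▸ hH, hX ▸ hdiff⟩
    · obtain ⟨q, hqc, hq, hdiff⟩ := exists_subset_infinite_diff hinf
      obtain ⟨X, hXS, hX⟩ := exists_isSubset_image (X := S) (q := q) (y := y) (hF.insert q)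
        (fun a ha => hyS a (hqc ha)) (fun π hπ a ha => ⟨(hπ q (Or.inl rfl) a).2 ha,
          hy π (fixes_anti (Set.subset_insert _ _) hπ) a (hqc ha)⟩)
      refine ⟨X, hXS, hX ▸ hq.image (hinj.mono hqc),
        (hdiff.image (f := y) (hinj.mono Set.sdiff_subset)).mono ?_⟩
      rintro _ ⟨a, ha, rfl⟩
      refine ⟨hyS a ha.1, fun h => ?_⟩
      rw [hX] at h
      obtain ⟨b, hb, hab⟩ := h
      exact ha.2 (hinj (hqc hb) ha.1 hab ▸ hb)
  obtain ⟨F, hF, hsupp⟩ := exists_supports_of_finite (Set.toFinite {S, X})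
  obtain ⟨Y, hY, hmem⟩ := exists_subset S {z | z ∉ X} hF (hsupp S (by simp))
    fun π hπ x _ hx h => hx (((hsupp X (by simp)).smul_mem_iff hπ).1 h)
  refine hno ⟨X, Y, hXS, ⟨hY, fun z hz => ((hmem z).1 hz).1⟩, isInfinite_iff.2 ⟨hXS.1, hX⟩,
    isInfinite_iff.2 ⟨hY, hdiff.mono fun z hz => (hmem z).2 hz⟩,
    fun z hz hz' => ((hmem z).1 hz').2 hz, fun z hz => ?_⟩
  by_cases h : z ∈ X
  · exact Or.inl h
  · exact Or.inr ((hmem z).2 ⟨hz, h⟩)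

theorem isMonochromatic_of_color {m : ℕ} {X Y χ : Vfp A} {c : Finset (Vfp A) → Vfp A}
    (hc : ∀ s : Finset (Vfp A), ↑s ⊆ {z | z ∈ X} → s.card = m →
      ∀ d, Related χ (finSet s) d ↔ d = c s) (hYX : IsSubset Y X) {k : Vfp A}
    (hk : ∀ s : Finset (Vfp A), ↑s ⊆ {z | z ∈ Y} → s.card = m → c s = k) :
    IsMonochromaticIn m χ Y k ∧ IsMonochromatic m χ Y := by
  have key : ∀ s d, IsSubsetOfSize m Y s → (Related χ s d ↔ d = k) := by
    intro s d hs
    obtain ⟨s, hsY, hm, rfl⟩ := isSubsetOfSize_iff.1 hs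
    rw [hc s (hsY.trans hYX.2) hm, hk s hsY hm]
  exact ⟨fun s hs => (key s k hs).2 rfl, fun s t d e hs ht hd he =>
    ((key s d hs).1 hd).trans ((key t e ht).1 he).symm⟩

/-- A coloring of the image of an infinite cell with invariant colors is constant. -/
theorem exists_monochromatic_image {m : ℕ} {X χ : Vfp A} {F : Set (Set A)} {q : A}
    {y : A → Vfp A} {c : Finset (Vfp A) → Vfp A} (hF : F.Finite) (hχ : Supports F χ)
    (hinf : (cell F q).Infinite)
    (hyX : ∀ a ∈ cell F q, y a ∈ X) (hinj : Set.InjOn y (cell F q))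
    (hy : ∀ π ∈ fixes F, ∀ a ∈ cell F q, π • y a = y ((π : Equiv.Perm A) a))
    (hc : ∀ s : Finset (Vfp A), ↑s ⊆ {z | z ∈ X} → s.card = m →
      ∀ d, Related χ (finSet s) d ↔ d = c s)
    (hinv : ∀ s : Finset (Vfp A), ↑s ⊆ {z | z ∈ X} → s.card = m →
      ∀ π : finitaryPerm A, π • c s = c s) :
    ∃ Y : Vfp A, IsSubset Y X ∧ {z | z ∈ Y} = y '' cell F q ∧
      ∃ s : Finset (Vfp A), ↑s ⊆ {z | z ∈ X} ∧ s.card = m ∧ IsMonochromaticIn m χ Y (c s) ∧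
        IsMonochromatic m χ Y := by
  classical
  obtain ⟨Y, hYX, hY⟩ := exists_isSubset_image hF hyX
    fun π hπ a ha => ⟨apply_mem_cell hπ ha, hy π hπ a ha⟩
  obtain ⟨s₀, hs₀, hm₀⟩ := hinf.exists_subset_card_eq m
  have himg : ∀ t : Finset A, ↑t ⊆ cell F q →
      ↑(t.image y) ⊆ {z | z ∈ X} ∧ (t.image y).card = t.card := by
    refine fun t ht => ⟨fun z hz => ?_, Finset.card_image_of_injOn (hinj.mono ht)⟩
    obtain ⟨a, ha, rfl⟩ := Finset.mem_image.1 (Finset.mem_coe.1 hz)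
    exact hyX a (ht ha)
  refine ⟨Y, hYX, hY, s₀.image y, (himg s₀ hs₀).1, (himg s₀ hs₀).2.trans hm₀,
    isMonochromatic_of_color hc hYX fun s hs hm => ?_⟩
  rw [hY] at hs
  obtain ⟨t, ht, rfl⟩ := Finset.subset_set_image_iff.1 hs
  rw [(himg t ht).2] at hm
  -- All `m`-subsets of the cell are conjugate to `s₀`, and invariant colors do not change under
  -- conjugation.
  obtain ⟨π, hπ, rfl⟩ := exists_image_eq _ s₀ t hs₀ ht (hm₀.trans hm.symm) rfl
  rw [color_image hχ hyX hinj hy hc hπ hs₀ hm₀,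
    hinv _ (himg s₀ hs₀).1 ((himg s₀ hs₀).2.trans hm₀)]

/-- Under a common support the external Ramsey theorem applies. Otherwise the whole image of the
cell is monochromatic, because the colors are numerals and hence invariant. -/
theorem rt (A : Type u) {m n : ℕ} (hn : n ≠ 0) : RT (Vfp A) m n := by
  intro X N χ hX hN hχ
  rw [isNumeral_iff] at hN
  subst hN
  obtain ⟨c, hc⟩ := exists_color hχ
  obtain ⟨F₀, hF₀, hsupp₀⟩ := exists_supports χ
  rcases exists_supports_or_cell X hF₀ with
    ⟨F, hF, hsupp⟩ | ⟨F, q, y, hF₀F, hF, hinf, hyX, hinj, hy⟩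
  · have hk : ∀ s : Finset (Vfp A), ∃ k : Fin n, ↑s ⊆ {z | z ∈ X} → s.card = m → c s = num k := by
      intro s
      by_cases hs : ↑s ⊆ {z | z ∈ X} ∧ s.card = m
      · obtain ⟨k, hk, h⟩ := mem_num.1 (hc s hs.1 hs.2).1
        exact ⟨⟨k, hk⟩, fun _ _ => h⟩
      -- Finsets that are not `m`-subsets of `X` get the junk color `0`.
      · exact ⟨⟨0, Nat.pos_of_ne_zero hn⟩, fun h1 h2 => (hs ⟨h1, h2⟩).elim⟩
    choose k hk using hk
    obtain ⟨H, hHX, hH, j, hj⟩ := ramsey m k (infinite_of_isInfinite hX)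
    obtain ⟨Y, hYX, hY⟩ := exists_isSubset_of_supports hF hsupp hHX
    refine ⟨Y, hYX, isInfinite_iff.2 ⟨hYX.1, hY ▸ hH⟩,
      (isMonochromatic_of_color (fun s hs hm => (hc s hs hm).2) hYX (k := num j)
        fun s hs hm => ?_).2⟩
    rw [hk s (hs.trans hYX.2) hm, hj s (hY ▸ hs) hm]
  · obtain ⟨Y, hYX, hY, -, -, -, -, hmono⟩ := exists_monochromatic_image hF (hsupp₀.mono hF₀F)
      hinf hyX hinj hy (fun s hs hm => (hc s hs hm).2) fun s hs hm π => by
        obtain ⟨k, -, h⟩ := mem_num.1 (hc s hs hm).1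
        rw [h, smul_num]
    exact ⟨Y, hYX, isInfinite_iff.2 ⟨hYX.1, hY ▸ hinf.image hinj⟩, hmono⟩

theorem isPolychromatic_of_color {m : ℕ} {X Y χ : Vfp A} {c : Finset (Vfp A) → Vfp A}
    (hc : ∀ s : Finset (Vfp A), ↑s ⊆ {z | z ∈ X} → s.card = m →
      ∀ d, Related χ (finSet s) d ↔ d = c s) (hYX : IsSubset Y X)
    (hY : ∀ s t : Finset (Vfp A), ↑s ⊆ {z | z ∈ Y} → ↑t ⊆ {z | z ∈ Y} → s.card = m →
      t.card = m → c s = c t → s = t) : IsPolychromatic m χ Y := by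
  intro s t d e hs ht hne hd he hde
  obtain ⟨s, hsY, hsm, rfl⟩ := isSubsetOfSize_iff.1 hs
  obtain ⟨t, htY, htm, rfl⟩ := isSubsetOfSize_iff.1 ht
  rw [hc s (hsY.trans hYX.2) hsm] at hd
  rw [hc t (htY.trans hYX.2) htm] at he
  exact hne (congrArg finSet (hY s t hsY htY hsm htm (hd.symm.trans (hde.trans he))))

/-- Without a common support the whole image of the cell is polychromatic. If `s ≠ t` had the same
color, take `b ∈ t \ s`: swapping `b` with any `b'` of the cell outside `s ∪ t` fixes `s` and hence
its color, so infinitely many copies of `t` would share that color. -/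
theorem rrt (A : Type u) (m n : ℕ) : RRT (Vfp A) m n := by
  classical
  intro X C χ hX _ hχ hbd
  obtain ⟨c, hc⟩ := exists_color hχ
  obtain ⟨F₀, hF₀, hsupp₀⟩ := exists_supports χ
  have hclass : ∀ k ∈ C,
      {s : Finset (Vfp A) | ↑s ⊆ {z | z ∈ X} ∧ s.card = m ∧ c s = k}.encard ≤ n := by
    intro k hk
    refine le_trans ?_ (hbd k hk)
    rw [← finSet_injective.encard_image]
    refine Set.encard_le_encard ?_
    rintro _ ⟨s, ⟨hs, hm, rfl⟩, rfl⟩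
    exact ((hc s hs hm).2 _).2 rfl
  rcases exists_supports_or_cell X hF₀ with
    ⟨F, hF, hsupp⟩ | ⟨F, q, y, hF₀F, hF, hinf, hyX, hinj, hy⟩
  · obtain ⟨H, hHX, hH, hpoly⟩ := rainbow_ramsey m n c (infinite_of_isInfinite hX) fun k => by
      by_cases hk : k ∈ C
      · exact hclass k hk
      · have : {s : Finset (Vfp A) | ↑s ⊆ {z | z ∈ X} ∧ s.card = m ∧ c s = k} = ∅ :=
          Set.eq_empty_of_forall_notMem fun s ⟨hs, hm, h⟩ => hk (h ▸ (hc s hs hm).1)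
        rw [this]
        simp
    obtain ⟨Y, hYX, hY⟩ := exists_isSubset_of_supports hF hsupp hHX
    exact ⟨Y, hYX, isInfinite_iff.2 ⟨hYX.1, hY ▸ hH⟩,
      isPolychromatic_of_color (fun s hs hm => (hc s hs hm).2) hYX (hY ▸ hpoly)⟩
  · obtain ⟨Y, hYX, hY⟩ := exists_isSubset_image hF hyX
      fun π hπ a ha => ⟨apply_mem_cell hπ ha, hy π hπ a ha⟩
    refine ⟨Y, hYX, isInfinite_iff.2 ⟨hYX.1, hY ▸ hinf.image hinj⟩,
      isPolychromatic_of_color (fun s hs hm => (hc s hs hm).2) hYX ?_⟩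
    rw [hY]
    intro s' t' hs' ht' hsm htm hst
    obtain ⟨s, hs, rfl⟩ := Finset.subset_set_image_iff.1 hs'
    obtain ⟨t, ht, rfl⟩ := Finset.subset_set_image_iff.1 ht'
    have himg : ∀ t : Finset A, ↑t ⊆ cell F q →
        ↑(t.image y) ⊆ {z | z ∈ X} ∧ (t.image y).card = t.card := by
      refine fun t ht => ⟨fun z hz => ?_, Finset.card_image_of_injOn (hinj.mono ht)⟩
      obtain ⟨a, ha, rfl⟩ := Finset.mem_image.1 (Finset.mem_coe.1 hz)
      exact hyX a (ht ha)
    by_contra hne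
    have hsX := (himg s hs).1
    have htX := (himg t ht).1
    have hmem := (hc _ hsX hsm).1
    rw [(himg s hs).2] at hsm
    rw [(himg t ht).2] at htm
    obtain ⟨b, hbt, hbs⟩ : ∃ b ∈ t, b ∉ s := by
      by_contra! h
      exact hne (congrArg _ (Finset.eq_of_subset_of_card_le h (hsm.trans htm.symm).le).symm)
    have hfin := Set.finite_of_encard_le_coe (hclass _ hmem)
    have hinf' : (cell F q \ ↑(s ∪ t)).Infinite := hinf.sdiff (s ∪ t).finite_toSet
    -- moving `b` yields infinitely many sets of the same color
    have hmaps : ∀ b' ∈ cell F q \ ↑(s ∪ t), ∃ π ∈ fixes F, π = swapPerm b b' ∧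
        ↑(t.image (π : Equiv.Perm A)) ⊆ cell F q ∧
        c ((t.image (π : Equiv.Perm A)).image y) = c (s.image y) := by
      rintro b' ⟨hb'q, hb'⟩
      have hswap : swapPerm b b' ∈ fixes F :=
        swapPerm_mem_fixes (by rw [cell_eq (ht hbt)]; exact hb'q)
      rw [Finset.mem_coe, Finset.mem_union, not_or] at hb'
      have hss : s.image (swapPerm b b' : Equiv.Perm A) = s := by
        conv_rhs => rw [← Finset.image_id (s := s)]
        refine Finset.image_congr fun a ha => ?_
        rw [swapPerm_val]
        refine Equiv.swap_apply_of_ne_of_ne ?_ ?_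
        · rintro rfl
          exact hbs ha
        · rintro rfl
          exact hb'.1 ha
      refine ⟨_, hswap, rfl, fun z hz => ?_, ?_⟩
      · obtain ⟨a, ha, rfl⟩ := Finset.mem_image.1 (Finset.mem_coe.1 hz)
        exact apply_mem_cell hswap (ht ha)
      · have hcol := fun {s : Finset A} hs hm => color_image (s := s) (hsupp₀.mono hF₀F) hyX hinj hy
          (fun s hs hm => (hc s hs hm).2) hswap hs hm
        rw [hcol ht htm, ← hst, ← hcol hs hsm, hss]
    refine hinf' (Set.Finite.of_injOn (f := fun b' =>
      (t.image (swapPerm b b' : Equiv.Perm A)).image y) (fun b' hb' => ?_) ?_ hfin)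
    · obtain ⟨π, hπ, rfl, hsub, hcol⟩ := hmaps b' hb'
      refine ⟨(himg _ hsub).1, ?_, hcol⟩
      rw [(himg _ hsub).2, Finset.card_image_of_injective _ (Equiv.injective _), htm]
    -- The moved copy of `t` has `b'` as its only point outside `t`, so `b'` can be recovered from
    -- it.
    · intro b₁ hb₁ b₂ hb₂ he
      obtain ⟨_, _, rfl, hsub₂, _⟩ := hmaps b₂ hb₂
      have h1 : y b₁ ∈ (t.image (swapPerm b b₁ : Equiv.Perm A)).image y :=
        Finset.mem_image_of_mem y (Finset.mem_image.2 ⟨b, hbt, by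
          rw [swapPerm_val, Equiv.swap_apply_left]⟩)
      simp only at he
      rw [he] at h1
      obtain ⟨d, hd, hyd⟩ := Finset.mem_image.1 h1
      have hdb := hinj (hsub₂ hd) hb₁.1 hyd
      rw [hdb] at hd
      obtain ⟨e, het, he'⟩ := Finset.mem_image.1 hd
      rw [swapPerm_val] at he'
      have hb₁t : b₁ ∉ t := fun h => hb₁.2 (Finset.mem_coe.2 (Finset.mem_union_right _ h))
      have hb₂t : b₂ ∉ t := fun h => hb₂.2 (Finset.mem_coe.2 (Finset.mem_union_right _ h))
      by_cases heb : e = b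
      · rw [heb, Equiv.swap_apply_left] at he'
        exact he'.symm
      · rw [Equiv.swap_apply_of_ne_of_ne heb fun h : e = b₂ => hb₂t (h ▸ het)] at he'
        exact (hb₁t (he' ▸ het)).elim

/-- Under a common support, countability in the model is external countability and the ambient
theorem applies. Otherwise the image of the cell is monochromatic; it is infinite, which settles
color `1`, and it is uncountable in the model, which settles color `0`. -/
theorem edm (A : Type u) : EDM (Vfp A) := by
  classical
  intro V E T zero one f hV _ _ h0 h1 h2 hf
  rw [isNumeral_iff] at h0 h1 h2
  subst h0 h1 h2
  obtain ⟨c, hc⟩ := exists_color hf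
  have hcol : ∀ s : Finset (Vfp A), ↑s ⊆ {z | z ∈ V} → s.card = 2 → c s = num 0 ∨ c s = num 1 := by
    intro s hs hm
    obtain ⟨k, hk, h⟩ := mem_num.1 (hc s hs hm).1
    interval_cases k
    · exact Or.inl h
    · exact Or.inr h
  obtain ⟨F₀, hF₀, hsupp₀⟩ := exists_supports f
  rcases exists_supports_or_cell V hF₀ with
    ⟨F, hF, hsupp⟩ | ⟨F, q, y, hF₀F, hF, hinf, hyX, hinj, hy⟩
  · have hunc : ¬ {z | z ∈ V}.Countable := fun h =>
      hV.2 (isCountable_iff.2 ⟨hV.1, h, F, hF, hsupp⟩)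
    have hmono : ∀ (Y : Vfp A) (k : Vfp A), IsSubset Y V →
        ({z | z ∈ Y}.Pairwise fun x z => c {x, z} = k) → IsMonochromaticIn 2 f Y k := by
      intro Y k hYV hpair
      refine (isMonochromatic_of_color (fun s hs hm => (hc s hs hm).2) hYV fun s hs hm => ?_).1
      obtain ⟨x, z, hxz, rfl⟩ := Finset.card_eq_two.1 hm
      exact hpair (hs (by simp)) (hs (by simp)) hxz
    rcases exists_uncountable_independent_or_infinite_clique (fun x z => c {x, z} = num 1)
      (fun x z h => by rwa [Finset.pair_comm]) hunc with ⟨H, hHV, hH, hpair⟩ | ⟨H, hHV, hH, hpair⟩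
    · obtain ⟨Y, hYV, hY⟩ := exists_isSubset_of_supports hF hsupp hHV
      refine Or.inl ⟨Y, hYV, ⟨hYV.1, fun h => hH (hY ▸ (isCountable_iff.1 h).2.1)⟩,
        hmono Y _ hYV ?_⟩
      rw [hY]
      intro x hx z hz hxz
      refine (hcol {x, z} ?_ (Finset.card_pair hxz)).resolve_right (hpair hx hz hxz)
      rw [Finset.coe_pair, Set.insert_subset_iff, Set.singleton_subset_iff]
      exact ⟨hHV hx, hHV hz⟩
    · obtain ⟨Y, hYV, hY⟩ := exists_isSubset_of_supports hF hsupp hHV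
      exact Or.inr ⟨Y, hYV, isInfinite_iff.2 ⟨hYV.1, hY ▸ hH⟩, hmono Y _ hYV (hY ▸ hpair)⟩
  · obtain ⟨Y, hYV, hY, s, hs, hm, hmono, -⟩ := exists_monochromatic_image hF (hsupp₀.mono hF₀F)
      hinf hyX hinj hy (fun s hs hm => (hc s hs hm).2) fun s hs hm π => by
        rcases hcol s hs hm with h | h <;> rw [h, smul_num]
    rcases hcol s hs hm with h | h <;> rw [h] at hmono
    · refine Or.inl ⟨Y, hYV, ⟨hYV.1, fun hcount => ?_⟩, hmono⟩
      obtain ⟨-, -, F', hF', hsupp'⟩ := isCountable_iff.1 hcount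
      -- A common support `F'` would leave two atoms of the cell unseparated; their transposition
      -- would fix `y a` and also carry it to `y b`.
      obtain ⟨d, hd⟩ := exists_infinite_inter_cell hinf hF'
      obtain ⟨a, ha, b, hb, hab⟩ := hd.nontrivial
      have hya : y a ∈ Y := hY.ge ⟨a, ha.1, rfl⟩
      have hπ : swapPerm a b ∈ fixes F := swapPerm_mem_fixes (by rw [cell_eq ha.1]; exact hb.1)
      have hπ' : swapPerm a b ∈ fixes F' := swapPerm_mem_fixes (by rw [cell_eq ha.2]; exact hb.2)
      have h1 := hy _ hπ a ha.1
      rw [hsupp' _ hya _ hπ', swapPerm_val, Equiv.swap_apply_left] at h1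
      exact hab (hinj ha.1 hb.1 h1)
    · exact Or.inr ⟨Y, hYV, isInfinite_iff.2 ⟨hYV.1, hY ▸ hinf.image hinj⟩, hmono⟩

end Vfp

end PermModel

theorem theorem6p5 :
    (∀ (A : Type u) [Countable A] [Infinite A],
      PermModel.IsModelOfZFA (PermModel.Vfp A) ∧
      (PermModel.CS (PermModel.Vfp A) ∧ PermModel.AntichainPrinciple (PermModel.Vfp A)) ∧
      (∀ m n : ℕ, 2 ≤ m → 2 ≤ n →
        PermModel.RRT (PermModel.Vfp A) m n ∧ PermModel.RT (PermModel.Vfp A) m n) ∧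
      PermModel.NoAmorphousSets (PermModel.Vfp A) ∧
      PermModel.EDM (PermModel.Vfp A)) ∧
    (∃ (U : Type (u + 1)) (_ : PermModel.SetStructure U),
      PermModel.IsModelOfZFA U ∧ PermModel.EDM U ∧ PermModel.CS U ∧
      PermModel.NoAmorphousSets U ∧
      ∀ m n : ℕ, 2 ≤ m → 2 ≤ n → PermModel.RRT U m n) := by
  open PermModel Vfp in
  exact ⟨fun A _ _ => ⟨isModelOfZFA A, ⟨cs A, antichainPrinciple A⟩,
      fun m n _ hn => ⟨rrt A m n, rt A (by omega)⟩, noAmorphousSets A, edm A⟩,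
    -- `ULift` supplies a countably infinite set of atoms in the universe `u`.
    Vfp (ULift.{u} ℕ), inferInstance, isModelOfZFA _, edm _, cs _, noAmorphousSets _,
    fun m n _ _ => rrt _ m n⟩
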